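/- Let $N$ be a number of degrees of freedom and let $\mathcal H=L^2(\mathbb R^N)$, with scalar product antilinear in the first argument. Let $\mathcal S(\mathbb R^n)$ be the space of complex Schwartz functions on $\mathbb R^n$ with its usual topology. For a multi-index $\alpha\in\mathbb N_0^N$ put $Q^\alpha=Q_1^{\alpha_1}\cdots Q_N^{\alpha_N}$ and $P^\alpha=P_1^{\alpha_1}\cdots P_N^{\alpha_N}$, where $Q_i$ is multiplication by $q_i$ and $P_i=-i\,\partial/\partial q_i$ on $\mathcal S(\mathbb R^N)$. A bounded operator $T$ on $\mathcal H$ is a *Schwartz operator* if for all $\alpha,\alpha',\beta,\beta'\in\mathbb N_0^N$ $$\|T\|_{\alpha,\alpha',\beta,\beta'}:=\sup\{|\langle P^\beta Q^\alpha\psi\,|\,TP^{\beta'}Q^{\alpha'}\varphi\rangle| \;:\; \psi,\varphi\in\mathcal S(\mathbb R^N),\ \|\psi\|\le 1,\ \|\varphi\|\le1\}<\infty .$$ The space $\mathcal S(\mathcal H)$ of Schwartz operators carries the locally convex topology given by these seminorms. A Hilbert–Schmidt operator $T$ on $\mathcal H$ has a unique kernel $K^T\in L^2(\mathbb R^{2N})=L^2(\mathbb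 R^N\times\mathbb R^N)$, characterised by $\langle\psi|T\varphi\rangle=\int\overline{\psi(q)}K^T(q,q')\varphi(q')\,dq\,dq'$ for all $\psi,\varphi\in\mathcal H$. Its matrix is the multisequence $a^T$ on $\mathbb N_0^{2N}$ with $a^T_{\alpha\vee\alpha'}=\langle\alpha|T|\alpha'\rangle$ for $\alpha,\alpha'\in\mathbb N_0^N$, where $\alpha\vee\alpha'=(\alpha_1,\dots,\alpha_N,\alpha'_1,\dots,\alpha'_N)$ and $|\alpha\rangle(q)=h_{\alpha_1}(q_1)\cdots h_{\alpha_N}(q_N)$ is the number basis, made of the normalised Hermite functions $h_n$ on $\mathbb R$. Let $\mathfrak s_n$ be the space of the multisequences $a=(a_\beta)_{\beta\in\mathbb N_0^n}$ of complex numbers such that for every $\alpha\in\mathbb N_0^n$ $$\|a\|_\alpha:=\Big(\sum_{\beta\in\mathbb N_0^n}\prod_{i=1}^n(\beta_i+1)^{2\alpha_i}\,|a_\beta|^2\Big)^{1/2}<\infty ,$$ with the locally convex topology given by these seminorms. **Proposition.** Let $T$ be a Hilbert–Schmidt operator on $\mathcal H$. The following conditions are equivalent: (i) $T\in\mathcal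 S(\mathcal H)$; (ii) $K^T\in\mathcal S(\mathbb R^{2N})$, i.e. the kernel of $T$ agrees almost everywhere with a Schwartz function; (iii) $a^T\in\mathfrak s_{2N}$. Moreover, every Schwartz operator is Hilbert–Schmidt, and the maps $$\mathcal S(\mathcal H)\ni T\mapsto K^T\in\mathcal S(\mathbb R^{2N}),\qquad \mathcal S(\mathcal H)\ni T\mapsto a^T\in\mathfrak s_{2N}$$ are (linear) topological isomorphisms onto $\mathcal S(\mathbb R^{2N})$ and onto $\mathfrak s_{2N}$, respectively. -/

import Mathlib

open MeasureTheory
open scoped SchwartzMap LineDeriv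

namespace SchwartzOperators

noncomputable section

/-- The configuration space `ℝ^N` with its Euclidean structure and Lebesgue measure. -/
abbrev Conf (N : ℕ) : Type := EuclideanSpace ℝ (Fin N)

/-- The Hilbert space `L²(ℝ^N)`. -/
abbrev HSpace (N : ℕ) : Type := Lp ℂ 2 (volume : Measure (Conf N))

/-- The space `L²(ℝ^{2N})`, where `ℝ^{2N}` is the cartesian product of two copies of `ℝ^N`. -/
abbrev KernelSpace (N : ℕ) : Type := Lp ℂ 2 (volume : Measure (Conf N × Conf N))

/-- Multi-indices with `n` entries. -/
abbrev MultiIndex (n : ℕ) : Type := Fin n → ℕ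

/-! ### Position, momentum and the Schwartz operators -/

/-- The position operator `Q_i` on `𝓢(ℝ^N)`, multiplication by the coordinate `q_i`. -/
def positionOp (N : ℕ) (i : Fin N) : 𝓢(Conf N, ℂ) →L[ℂ] 𝓢(Conf N, ℂ) :=
  SchwartzMap.smulLeftCLM ℂ (fun q : Conf N => ((q i : ℝ) : ℂ))

/-- The momentum operator `P_i = -i ∂/∂q_i` on `𝓢(ℝ^N)`. -/
def momentumOp (N : ℕ) (i : Fin N) : 𝓢(Conf N, ℂ) →L[ℂ] 𝓢(Conf N, ℂ) :=
  (-Complex.I) • LineDeriv.lineDerivOpCLM ℂ 𝓢(Conf N, ℂ) (EuclideanSpace.single i (1 : ℝ))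

theorem positionOp_apply (N : ℕ) (i : Fin N) (ψ : 𝓢(Conf N, ℂ)) (q : Conf N) :
    positionOp N i ψ q = (q i : ℂ) * ψ q := by
  have h : Function.HasTemperateGrowth (fun q : Conf N => ((q i : ℝ) : ℂ)) :=
    (Complex.ofRealCLM.comp (EuclideanSpace.proj i : Conf N →L[ℝ] ℝ)).hasTemperateGrowth
  simp [positionOp, SchwartzMap.smulLeftCLM_apply_apply h]

theorem momentumOp_apply (N : ℕ) (i : Fin N) (ψ : 𝓢(Conf N, ℂ)) (q : Conf N) :
    momentumOp N i ψ q =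
      -Complex.I * lineDeriv ℝ (ψ : Conf N → ℂ) q (EuclideanSpace.single i (1 : ℝ)) := by
  simp [momentumOp, SchwartzMap.lineDerivOp_apply]

/-- `A^α = A_1^{α_1} ⋯ A_N^{α_N}` for a tuple `A` of operators on `𝓢(ℝ^N)`. -/
def opPow {N : ℕ} (A : Fin N → (𝓢(Conf N, ℂ) →L[ℂ] 𝓢(Conf N, ℂ))) (α : MultiIndex N) :
    𝓢(Conf N, ℂ) →L[ℂ] 𝓢(Conf N, ℂ) :=
  (List.ofFn fun i => A i ^ α i).prod

/-- The Schwartz function `P^β Q^α ψ`. -/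
def momPos {N : ℕ} (β α : MultiIndex N) (ψ : 𝓢(Conf N, ℂ)) : 𝓢(Conf N, ℂ) :=
  opPow (momentumOp N) β (opPow (positionOp N) α ψ)

/-- The set of all `|⟨P^β Q^α ψ | T P^{β'} Q^{α'} φ⟩|` with `ψ, φ` Schwartz functions in the unit
ball of `L²(ℝ^N)`. -/
def formValues {N : ℕ} (α α' β β' : MultiIndex N) (T : HSpace N →L[ℂ] HSpace N) : Set ℝ :=
  {r | ∃ ψ φ : 𝓢(Conf N, ℂ), ‖ψ.toLp 2 volume‖ ≤ 1 ∧ ‖φ.toLp 2 volume‖ ≤ 1 ∧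
    r = ‖inner ℂ ((momPos β α ψ).toLp 2 volume) (T ((momPos β' α' φ).toLp 2 volume))‖}

/-- `T` is a Schwartz operator if all the suprema `‖T‖_{α,α',β,β'}` are finite. -/
def IsSchwartzOperator {N : ℕ} (T : HSpace N →L[ℂ] HSpace N) : Prop :=
  ∀ α α' β β' : MultiIndex N, BddAbove (formValues α α' β β' T)

/-- `‖T‖_{α,α',β,β'}` (meaningful when the supremum is finite). -/
def schwartzOpNorm {N : ℕ} (α α' β β' : MultiIndex N) (T : HSpace N →L[ℂ] HSpace N) : ℝ :=
  sSup (formValues α α' β β' T)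

section FormValues

variable {N : ℕ} (α α' β β' : MultiIndex N)

theorem formValues_nonempty (T : HSpace N →L[ℂ] HSpace N) :
    (formValues α α' β β' T).Nonempty := by
  have h : ‖(0 : 𝓢(Conf N, ℂ)).toLp 2 volume‖ ≤ 1 := by
    have h0 := (SchwartzMap.toLpCLM ℂ ℂ 2 (volume : Measure (Conf N))).map_zero
    rw [SchwartzMap.toLpCLM_apply] at h0
    simp [h0]
  exact ⟨_, 0, 0, h, h, rfl⟩

theorem formValues_add_le {S T : HSpace N →L[ℂ] HSpace N}
    (hS : BddAbove (formValues α α' β β' S)) (hT : BddAbove (formValues α α' β β' T)) {r : ℝ}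
    (hr : r ∈ formValues α α' β β' (S + T)) :
    r ≤ schwartzOpNorm α α' β β' S + schwartzOpNorm α α' β β' T := by
  obtain ⟨ψ, φ, h1, h2, rfl⟩ := hr
  rw [_root_.add_apply, inner_add_right]
  exact (norm_add_le _ _).trans
    (add_le_add (le_csSup hS ⟨ψ, φ, h1, h2, rfl⟩) (le_csSup hT ⟨ψ, φ, h1, h2, rfl⟩))

theorem formValues_smul_le {T : HSpace N →L[ℂ] HSpace N}
    (hT : BddAbove (formValues α α' β β' T)) (c : ℂ) {r : ℝ}
    (hr : r ∈ formValues α α' β β' (c • T)) :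
    r ≤ ‖c‖ * schwartzOpNorm α α' β β' T := by
  obtain ⟨ψ, φ, h1, h2, rfl⟩ := hr
  rw [_root_.smul_apply, inner_smul_right, norm_mul]
  exact mul_le_mul_of_nonneg_left (le_csSup hT ⟨ψ, φ, h1, h2, rfl⟩) (norm_nonneg c)

theorem schwartzOpNorm_zero : schwartzOpNorm α α' β β' (0 : HSpace N →L[ℂ] HSpace N) = 0 := by
  have h : ∀ r ∈ formValues α α' β β' (0 : HSpace N →L[ℂ] HSpace N), r = 0 := by
    rintro r ⟨ψ, φ, -, -, rfl⟩
    simp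
  rw [schwartzOpNorm, Set.eq_singleton_iff_nonempty_unique_mem.2 ⟨formValues_nonempty _ _ _ _ _, h⟩,
    csSup_singleton]

end FormValues

/-- The linear subspace `𝓢(H)` of Schwartz operators in the bounded operators. -/
def schwartzOperatorSubmodule (N : ℕ) : Submodule ℂ (HSpace N →L[ℂ] HSpace N) where
  carrier := {T | IsSchwartzOperator T}
  zero_mem' α α' β β' := ⟨0, by
    rintro r ⟨ψ, φ, -, -, rfl⟩
    simp⟩
  add_mem' hS hT α α' β β' :=
    ⟨_, fun _ hr => formValues_add_le α α' β β' (hS α α' β β') (hT α α' β β') hr⟩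
  smul_mem' c _ hT α α' β β' :=
    ⟨_, fun _ hr => formValues_smul_le α α' β β' (hT α α' β β') c hr⟩

/-- The space `𝓢(H)`. It is a type of its own, since its topology (below) is not the one induced by
the operator norm. -/
def SchwartzOperator (N : ℕ) : Type := schwartzOperatorSubmodule N

namespace SchwartzOperator

variable {N : ℕ}

instance : AddCommGroup (SchwartzOperator N) :=
  inferInstanceAs (AddCommGroup (schwartzOperatorSubmodule N))

instance : Module ℂ (SchwartzOperator N) :=
  inferInstanceAs (Module ℂ (schwartzOperatorSubmodule N))

/-- The inclusion of `𝓢(H)` into the bounded operators. -/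
def toCLM (T : SchwartzOperator N) : HSpace N →L[ℂ] HSpace N := T.1

theorem isSchwartzOperator (T : SchwartzOperator N) : IsSchwartzOperator T.toCLM := T.2

/-- The seminorm `‖·‖_{α,α',β,β'}` on `𝓢(H)`, with `a = (α, α', β, β')`. -/
def seminormFamily (N : ℕ) : SeminormFamily ℂ (SchwartzOperator N)
    (MultiIndex N × MultiIndex N × MultiIndex N × MultiIndex N) := fun a =>
  Seminorm.ofSMulLE (fun T => schwartzOpNorm a.1 a.2.1 a.2.2.1 a.2.2.2 T.toCLM)
    (schwartzOpNorm_zero _ _ _ _)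
    (fun S T => csSup_le (formValues_nonempty _ _ _ _ _) fun _ hr =>
      formValues_add_le _ _ _ _ (S.2 _ _ _ _) (T.2 _ _ _ _) hr)
    (fun c T => csSup_le (formValues_nonempty _ _ _ _ _) fun _ hr =>
      formValues_smul_le _ _ _ _ (T.2 _ _ _ _) c hr)

/-- The topology of `𝓢(H)` is the locally convex one given by the seminorms `‖·‖_{α,α',β,β'}`. -/
instance : TopologicalSpace (SchwartzOperator N) :=
  (seminormFamily N).moduleFilterBasis.topology'

theorem withSeminorms : WithSeminorms (seminormFamily N) :=
  ⟨rfl⟩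

end SchwartzOperator

/-! ### Schwartz multisequences -/

/-- The weight `(β + 1)^α = ∏ i, (β_i + 1)^{α_i}`. -/
def weight {n : ℕ} (α β : MultiIndex n) : ℝ := ∏ i, ((β i : ℝ) + 1) ^ α i

theorem norm_weight_mul_sq {n : ℕ} (α β : MultiIndex n) (z : ℂ) :
    ‖(weight α β : ℂ) * z‖ ^ 2 = (∏ i, ((β i : ℝ) + 1) ^ (2 * α i)) * ‖z‖ ^ 2 := by
  rw [norm_mul, mul_pow, Complex.norm_real, Real.norm_eq_abs, sq_abs, weight, ← Finset.prod_pow]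
  simp only [pow_mul']

/-- `(a_β)` is a Schwartz multisequence if `((β + 1)^α a_β)_β` is in `ℓ²` for each `α`. -/
def IsSchwartzSeq {n : ℕ} (a : MultiIndex n → ℂ) : Prop :=
  ∀ α : MultiIndex n, Memℓp (fun β => (weight α β : ℂ) * a β) 2

theorem isSchwartzSeq_iff {n : ℕ} (a : MultiIndex n → ℂ) :
    IsSchwartzSeq a ↔
      ∀ α : MultiIndex n, Summable fun β => (∏ i, ((β i : ℝ) + 1) ^ (2 * α i)) * ‖a β‖ ^ 2 := by
  refine forall_congr' fun α => ?_
  rw [memℓp_gen_iff (by norm_num)]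
  refine summable_congr fun β => ?_
  rw [← norm_weight_mul_sq]
  simp

/-- The linear space `𝔰_n` of Schwartz multisequences. -/
def schwartzSeqSubmodule (n : ℕ) : Submodule ℂ (MultiIndex n → ℂ) where
  carrier := {a | IsSchwartzSeq a}
  zero_mem' α := by
    have h : (fun β => (weight α β : ℂ) * (0 : MultiIndex n → ℂ) β) = 0 := by ext; simp
    rw [h]
    exact zero_memℓp
  add_mem' {a b} ha hb α := by
    have h : (fun β => (weight α β : ℂ) * (a + b) β) =
        (fun β => (weight α β : ℂ) * a β) + fun β => (weight α β : ℂ) * b β := by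
      ext; simp [mul_add]
    rw [h]
    exact (ha α).add (hb α)
  smul_mem' c {a} ha α := by
    have h : (fun β => (weight α β : ℂ) * (c • a) β) = c • fun β => (weight α β : ℂ) * a β := by
      ext; simp [mul_left_comm]
    rw [h]
    exact (ha α).const_smul c

/-- The space `𝔰_n`. It is a type of its own, since its topology (below) is not the one of pointwise
convergence. -/
def SchwartzSeq (n : ℕ) : Type := schwartzSeqSubmodule n

namespace SchwartzSeq

variable {n : ℕ}

instance : AddCommGroup (SchwartzSeq n) := inferInstanceAs (AddCommGroup (schwartzSeqSubmodule n))

instance : Module ℂ (SchwartzSeq n) := inferInstanceAs (Module ℂ (schwartzSeqSubmodule n))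

/-- The underlying multisequence. -/
def toFun (a : SchwartzSeq n) : MultiIndex n → ℂ := a.1

/-- The map `(a_β) ↦ ((β + 1)^α a_β)` from `𝔰_n` to `ℓ²`. -/
def weightMap (α : MultiIndex n) : SchwartzSeq n →ₗ[ℂ] lp (fun _ : MultiIndex n => ℂ) 2 where
  toFun a := ⟨fun β => (weight α β : ℂ) * a.1 β, a.2 α⟩
  map_add' a b := by
    ext β
    exact mul_add _ _ _
  map_smul' c a := by
    ext β
    exact mul_left_comm _ _ _

/-- The seminorm `‖(a_β)‖_α`, the `ℓ²`-norm of `((β + 1)^α a_β)`. -/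
def seminormFamily (n : ℕ) : SeminormFamily ℂ (SchwartzSeq n) (MultiIndex n) := fun α =>
  (normSeminorm ℂ (lp (fun _ : MultiIndex n => ℂ) 2)).comp (weightMap α)

theorem seminormFamily_apply (α : MultiIndex n) (a : SchwartzSeq n) :
    seminormFamily n α a =
      √(∑' β, (∏ i, ((β i : ℝ) + 1) ^ (2 * α i)) * ‖a.toFun β‖ ^ 2) := by
  have h : seminormFamily n α a = ‖weightMap α a‖ := rfl
  rw [h, lp.norm_eq_tsum_rpow (by norm_num), Real.sqrt_eq_rpow]
  simp only [← norm_weight_mul_sq]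
  simp [weightMap, SchwartzSeq.toFun]

/-- The topology of `𝔰_n` is the locally convex one given by the seminorms `‖·‖_α`. -/
instance : TopologicalSpace (SchwartzSeq n) := (seminormFamily n).moduleFilterBasis.topology'

theorem withSeminorms : WithSeminorms (seminormFamily n) :=
  ⟨rfl⟩

end SchwartzSeq

/-! ### The number basis -/

/-- The Hermite function `h_n(x) = (2^n n! √π)^{-1/2} H_n(x) e^{-x²/2}`. It is written with the
probabilists' Hermite polynomial `He_n` through `H_n(x) = 2^{n/2} He_n(√2 x)`. -/
def hermiteFun (n : ℕ) (x : ℝ) : ℝ :=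
  (√(n.factorial * √Real.pi))⁻¹ * Polynomial.aeval (√2 * x) (Polynomial.hermite n) *
    Real.exp (-x ^ 2 / 2)

/-- The function `|α⟩(q) = h_{α_1}(q_1) ⋯ h_{α_N}(q_N)`. -/
def numberFun {N : ℕ} (α : MultiIndex N) (q : Conf N) : ℂ :=
  ((∏ i, hermiteFun (α i) (q i) : ℝ) : ℂ)

theorem continuous_hermiteFun (n : ℕ) : Continuous (hermiteFun n) := by
  unfold hermiteFun
  have : Continuous fun x : ℝ => Polynomial.aeval (√2 * x) (Polynomial.hermite n) :=
    (Polynomial.continuous_aeval (Polynomial.hermite n)).comp (by fun_prop)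
  fun_prop

theorem integrable_poly_mul_gaussian (p : Polynomial ℝ) :
    Integrable fun x : ℝ => p.eval x * Real.exp (-x ^ 2) := by
  induction p using Polynomial.induction_on' with
  | add p q hp hq => 
    refine (hp.add hq).congr (Filter.Eventually.of_forall fun x => ?_)
    simp [add_mul]
  | monomial k c =>
    have h := integrable_rpow_mul_exp_neg_mul_sq (b := 1) one_pos (s := k)
      (lt_of_lt_of_le (by norm_num) (Nat.cast_nonneg k))
    simpa [mul_assoc] using h.const_mul c

theorem integrable_hermiteFun_sq (n : ℕ) : Integrable fun x : ℝ => hermiteFun n x ^ 2 := by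
  let p : Polynomial ℝ := ((Polynomial.hermite n).map (algebraMap ℤ ℝ)).comp
    (Polynomial.C (√2) * Polynomial.X)
  have h := (integrable_poly_mul_gaussian (p ^ 2)).const_mul ((√(n.factorial * √Real.pi))⁻¹ ^ 2)
  refine h.congr (Filter.Eventually.of_forall fun x => ?_)
  have e : Real.exp (-x ^ 2) = Real.exp (-x ^ 2 / 2) ^ 2 := by
    rw [← Real.exp_nat_mul]; congr 1; push_cast; ring
  have e2 : p.eval x = Polynomial.aeval (√2 * x) (Polynomial.hermite n) := by
    
    rw [Polynomial.eval_comp, Polynomial.eval_map_algebraMap]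
    simp
  simp only [Polynomial.eval_pow, e, e2, hermiteFun]
  ring

theorem memLp_numberFun {N : ℕ} (α : MultiIndex N) :
    MemLp (numberFun α) 2 (volume : Measure (Conf N)) := by
  have hc : Continuous (numberFun α) := by
    unfold numberFun
    refine Complex.continuous_ofReal.comp (continuous_finsetProd _ fun i _ => ?_)
    exact (continuous_hermiteFun _).comp (by fun_prop)
  rw [memLp_two_iff_integrable_sq_norm hc.aestronglyMeasurable]
  have h : Integrable (fun x : Fin N → ℝ => ∏ i, hermiteFun (α i) (x i) ^ 2) :=
    Integrable.fintype_prod fun i => integrable_hermiteFun_sq (α i)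
  refine ((PiLp.volume_preserving_ofLp (Fin N)).integrable_comp_of_integrable h).congr
    (Filter.Eventually.of_forall fun q => ?_)
  simp only [numberFun, Function.comp, Complex.norm_real, Real.norm_eq_abs, sq_abs, Finset.prod_pow]

/-- The number basis vector `|α⟩` of `L²(ℝ^N)`. -/
def numberState {N : ℕ} (α : MultiIndex N) : HSpace N := (memLp_numberFun α).toLp _

/-! ### Hilbert–Schmidt operators, their kernels and matrices -/

/-- `T` is Hilbert–Schmidt: `Tr(T* T) = ∑ ‖T b_i‖²` is finite in some (equivalently, in every)
orthonormal basis of `L²(ℝ^N)`. -/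
def IsHilbertSchmidt {N : ℕ} (T : HSpace N →L[ℂ] HSpace N) : Prop :=
  ∃ (ι : Type) (b : HilbertBasis ι ℂ (HSpace N)), Summable fun i => ‖T (b i)‖ ^ 2

/-- `K ∈ L²(ℝ^{2N})` is a kernel of `T`:
`⟨ψ|Tφ⟩ = ∫ conj (ψ(q)) K(q,q') φ(q') dq dq'` for all `ψ, φ ∈ L²(ℝ^N)`. -/
def IsKernel {N : ℕ} (T : HSpace N →L[ℂ] HSpace N) (K : KernelSpace N) : Prop :=
  ∀ ψ φ : HSpace N, inner ℂ ψ (T φ) =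
    ∫ z : Conf N × Conf N, starRingEnd ℂ (ψ z.1) * K z * φ z.2

open Classical in
/-- The kernel of `T`; it is used only for operators with a (necessarily unique) kernel. -/
def kernelOf {N : ℕ} (T : HSpace N →L[ℂ] HSpace N) : KernelSpace N :=
  if h : ∃ K, IsKernel T K then h.choose else 0

/-- The matrix of `T` in the number basis, `a_{α∨α'} = ⟨α|T|α'⟩`, where `α∨α'` is the
concatenation of `α` and `α'`. -/
def matrixOf {N : ℕ} (T : HSpace N →L[ℂ] HSpace N) : MultiIndex (N + N) → ℂ := fun γ =>
  inner ℂ (numberState fun i => γ (Fin.castAdd N i)) (T (numberState fun i => γ (Fin.natAdd N i)))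

theorem matrixOf_append {N : ℕ} (T : HSpace N →L[ℂ] HSpace N) (α α' : MultiIndex N) :
    matrixOf T (Fin.append α α') = inner ℂ (numberState α) (T (numberState α')) := by
  simp only [matrixOf, Fin.append_left, Fin.append_right]

end

end SchwartzOperators

open SchwartzOperators

/-! ### Hermite functions of one variable: ladder relations and orthonormality. -/

namespace SchwartzOperators

noncomputable section

/-! Everything passes through the matrix in the number basis. Schwartz functions on ℝ^{2N} and
Schwartz operators are each identified with the rapidly decreasing multisequences, and the kernel
map is the composite of the two identifications. They fit together because |γ⟩ on ℝ^{2N} is the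
product of the real functions |α⟩ and |α'⟩ for the two halves of γ, so the Hermite coefficients of
the kernel are the matrix elements of T (`isKernel_iff`).

Each identification needs an estimate in each direction. For decay, P_i² + Q_i² is formally
symmetric and has |γ⟩ as eigenvector with eigenvalue 2γ_i + 1. Moving its powers onto a Schwartz
function, or putting them on both sides of T, gains any power of ∏(γ_i + 1)
(`exists_basicWeight_pow_mul_norm_hermiteCoeff_le`, `exists_bound_matrixOf`). For operators these
powers must first be expanded into words P^β Q^α by the commutation relations, since only such words
occur in the seminorms (`opPow_numberOp_mem_normalSpan`). Conversely, the Schwartz seminorms of |γ⟩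
grow at most polynomially in γ (`isPolyBounded_norm_pow_mul_iteratedFDeriv_numberFun`), so ∑ a_γ |γ⟩
and ∑ a_{α∨α'} |α⟩⟨α'| are controlled by seminorms of a. All bounds are by continuous seminorms,
hence both bijections are homeomorphisms.

Injectivity is the completeness of the number basis (`eq_zero_of_inner_numberState_eq_zero`): if f
is orthogonal to every |γ⟩, all moments of |0⟩f vanish, hence so does its Fourier transform.
Completeness also yields, with the basis independence of the Hilbert–Schmidt condition, the
existence and uniqueness of kernels. -/

theorem derivative_hermite_succ (n : ℕ) :
    Polynomial.derivative (Polynomial.hermite (n + 1)) = (n + 1) * Polynomial.hermite n := by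
  induction n with
  | zero => simp
  | succ n ih =>
    rw [Polynomial.hermite_succ (n + 1), Polynomial.derivative_sub, Polynomial.derivative_mul, ih,
      Polynomial.derivative_mul]
    rw [Polynomial.hermite_succ n]
    simp only [Polynomial.derivative_X, Polynomial.derivative_add, Polynomial.derivative_natCast,
      Polynomial.derivative_one]
    push_cast
    ring

theorem derivative_hermite (n : ℕ) :
    Polynomial.derivative (Polynomial.hermite n) = n * Polynomial.hermite (n - 1) := by
  cases n with
  | zero => simp
  | succ n => simpa using derivative_hermite_succ n

/-- The normalisation constant of `hermiteFun`. -/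
def hermiteConst (n : ℕ) : ℝ := (√(n.factorial * √Real.pi))⁻¹

theorem hermiteConst_eq_sqrt_mul_succ (n : ℕ) :
    hermiteConst n = √(n + 1) * hermiteConst (n + 1) := by
  unfold hermiteConst
  rw [Nat.factorial_succ]
  push_cast
  rw [mul_assoc, Real.sqrt_mul (by positivity) (_ * _), mul_inv]
  field_simp

theorem natCast_mul_hermiteConst (n : ℕ) :
    n * hermiteConst n = √n * hermiteConst (n - 1) := by
  cases n with
  | zero => simp
  | succ n =>
    rw [Nat.add_sub_cancel, hermiteConst_eq_sqrt_mul_succ n, ← mul_assoc]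
    push_cast
    rw [Real.mul_self_sqrt (by positivity)]

theorem hermiteFun_eq (n : ℕ) (x : ℝ) : hermiteFun n x =
    hermiteConst n * Polynomial.aeval (√2 * x) (Polynomial.hermite n) * Real.exp (-x ^ 2 / 2) :=
  rfl

/-- The recurrence He_{n+1} = x He_n - n He_{n-1} at √2 x, with the normalising constants absorbed
into the square roots. At n = 0 the truncated index n - 1 is harmless, its coefficient being zero.
-/
theorem mul_hermiteFun (n : ℕ) (x : ℝ) :
    x * hermiteFun n x = √((n + 1) / 2) * hermiteFun (n + 1) x +
      √(n / 2) * hermiteFun (n - 1) x := by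
  have h : √2 * x * Polynomial.aeval (√2 * x) (Polynomial.hermite n) =
      Polynomial.aeval (√2 * x) (Polynomial.hermite (n + 1)) +
        n * Polynomial.aeval (√2 * x) (Polynomial.hermite (n - 1)) := by
    rw [Polynomial.hermite_succ, derivative_hermite]
    simp
  have h2 : √2 * √2 = 2 := Real.mul_self_sqrt (by norm_num)
  have hs : √2 ≠ 0 := by positivity
  rw [Real.sqrt_div' _ (by norm_num), Real.sqrt_div' _ (by norm_num)]
  apply mul_left_cancel₀ hs
  have e1 := hermiteConst_eq_sqrt_mul_succ n
  have e2 := natCast_mul_hermiteConst n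
  simp only [hermiteFun_eq]
  set A := Polynomial.aeval (√2 * x) (Polynomial.hermite (n + 1))
  set B := Polynomial.aeval (√2 * x) (Polynomial.hermite (n - 1))
  set H := Polynomial.aeval (√2 * x) (Polynomial.hermite n)
  set E := Real.exp (-x ^ 2 / 2)
  calc √2 * (x * (hermiteConst n * H * E)) = hermiteConst n * (√2 * x * H) * E := by ring
    _ = (hermiteConst n * A + n * hermiteConst n * B) * E := by rw [h]; ring
    _ = (√(n + 1) * hermiteConst (n + 1) * A + √n * hermiteConst (n - 1) * B) * E := by
      rw [e2, ← e1]
    _ = _ := by field_simp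

/-- Differentiating the polynomial gives twice the lowering term; the Gaussian contributes -x h_n,
which the recurrence for x h_n turns into minus the lowering and raising terms. -/
theorem hasDerivAt_hermiteFun (n : ℕ) (x : ℝ) :
    HasDerivAt (hermiteFun n)
      (√(n / 2) * hermiteFun (n - 1) x - √((n + 1) / 2) * hermiteFun (n + 1) x) x := by
  have h1 : HasDerivAt (fun x : ℝ => Polynomial.aeval (√2 * x) (Polynomial.hermite n))
      (Polynomial.aeval (√2 * x) (Polynomial.derivative (Polynomial.hermite n)) * √2) x := by
    have := ((Polynomial.hermite n).hasDerivAt_aeval (√2 * x)).comp x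
      ((hasDerivAt_id x).const_mul (√2))
    simpa [Function.comp_def] using! this
  have h2 : HasDerivAt (fun x : ℝ => Real.exp (-x ^ 2 / 2)) (Real.exp (-x ^ 2 / 2) * (-x)) x := by
    have : HasDerivAt (fun x : ℝ => -x ^ 2 / 2) (-x) x := by
      convert! ((hasDerivAt_pow 2 x).neg.div_const 2) using 1
      simp
      ring
    exact this.exp
  have h3 := (h1.const_mul (hermiteConst n)).mul h2
  convert! h3 using 1
  rw [derivative_hermite]
  have hx := mul_hermiteFun n x
  have hs : √((n : ℝ) / 2) * √2 * √2 = √n * √2 := by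
    rw [Real.sqrt_div' _ (by norm_num)]
    field_simp
  have hs' : √((n : ℝ) / 2) * 2 = √n * √2 := by
    rw [← hs, mul_assoc, Real.mul_self_sqrt (by norm_num)]
  have e2 := natCast_mul_hermiteConst n
  simp only [map_mul, map_natCast]
  have : √((n + 1 : ℝ) / 2) * hermiteFun (n + 1) x =
    x * hermiteFun n x - √(n / 2) * hermiteFun (n - 1) x := by rw [hx]; ring
  rw [this]
  simp only [hermiteFun_eq]
  set B := Polynomial.aeval (√2 * x) (Polynomial.hermite (n - 1))
  set H := Polynomial.aeval (√2 * x) (Polynomial.hermite n)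
  set E := Real.exp (-x ^ 2 / 2)
  linear_combination (hermiteConst (n - 1) * B * E) * hs' - (B * E * √2) * e2

theorem hermiteFun_zero (x : ℝ) : hermiteFun 0 x = hermiteConst 0 * Real.exp (-x ^ 2 / 2) := by
  simp [hermiteFun_eq]

theorem hermiteConst_pos (n : ℕ) : 0 < hermiteConst n := by
  unfold hermiteConst; positivity

theorem memLp_hermiteFun (n : ℕ) : MemLp (hermiteFun n) 2 :=
  (memLp_two_iff_integrable_sq (continuous_hermiteFun n).aestronglyMeasurable).2
    (integrable_hermiteFun_sq n)

theorem integrable_hermiteFun_mul (n m : ℕ) :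
    Integrable fun x => hermiteFun n x * hermiteFun m x :=
  (memLp_hermiteFun n).integrable_mul (memLp_hermiteFun m)

theorem integral_deriv_hermiteFun_mul (n m : ℕ) :
    ∫ x, (√(n / 2) * hermiteFun (n - 1) x - √((n + 1) / 2) * hermiteFun (n + 1) x) *
      hermiteFun m x =
    - ∫ x, hermiteFun n x *
      (√(m / 2) * hermiteFun (m - 1) x - √((m + 1) / 2) * hermiteFun (m + 1) x) := by
  have key := integral_mul_deriv_eq_deriv_mul_of_integrable
    (u := hermiteFun n) (v := hermiteFun m) (fun x _ => hasDerivAt_hermiteFun n x)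
    (fun x _ => hasDerivAt_hermiteFun m x) ?_ ?_ (integrable_hermiteFun_mul n m)
  · rw [key, neg_neg]
  · convert! ((integrable_hermiteFun_mul n (m - 1)).const_mul √(m / 2)).sub
      ((integrable_hermiteFun_mul n (m + 1)).const_mul √((m + 1) / 2)) using 1
    ext x; simp; ring
  · convert! ((integrable_hermiteFun_mul (n - 1) m).const_mul √(n / 2)).sub
      ((integrable_hermiteFun_mul (n + 1) m).const_mul √((n + 1) / 2)) using 1
    ext x; simp; ring

/-- `⟨a† h_n, h_m⟩ = ⟨h_n, a h_m⟩`. -/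
theorem sqrt_mul_integral_hermiteFun_succ_mul (n m : ℕ) :
    √((n + 1) / 2) * ∫ x, hermiteFun (n + 1) x * hermiteFun m x =
      √(m / 2) * ∫ x, hermiteFun n x * hermiteFun (m - 1) x := by
  have h1 := integral_deriv_hermiteFun_mul n m
  have h2 : ∫ x, (√((n + 1) / 2) * hermiteFun (n + 1) x + √(n / 2) * hermiteFun (n - 1) x) *
      hermiteFun m x = ∫ x, hermiteFun n x *
      (√((m + 1) / 2) * hermiteFun (m + 1) x + √(m / 2) * hermiteFun (m - 1) x) := by
    congr 1; ext x; rw [← mul_hermiteFun, ← mul_hermiteFun]; ring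
  simp only [add_mul, sub_mul, mul_add, mul_sub, mul_left_comm (hermiteFun n _), mul_assoc] at h1 h2
  have I := fun (c : ℝ) a b => (integrable_hermiteFun_mul a b).const_mul c
  rw [integral_sub (I _ _ _) (I _ _ _), integral_sub (I _ _ _) (I _ _ _)] at h1
  rw [integral_add (I _ _ _) (I _ _ _), integral_add (I _ _ _) (I _ _ _)] at h2
  simp only [integral_const_mul] at h1 h2
  -- Multiplication by x is symmetric and d/dx antisymmetric, so subtracting `h1` from `h2` leaves
  -- twice the raising term on the left and twice the lowering term on the right.
  linarith

theorem integral_hermiteFun_zero_sq : ∫ x, hermiteFun 0 x * hermiteFun 0 x = 1 := by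
  have h : ∀ x, hermiteFun 0 x * hermiteFun 0 x = hermiteConst 0 ^ 2 * Real.exp (-1 * x ^ 2) := by
    intro x
    rw [hermiteFun_zero]
    have : Real.exp (-1 * x ^ 2) = Real.exp (-x ^ 2 / 2) * Real.exp (-x ^ 2 / 2) := by
      rw [← Real.exp_add]; ring_nf
    rw [this]; ring
  simp only [h]
  rw [integral_const_mul, integral_gaussian, hermiteConst]
  simp
  rw [inv_mul_cancel₀ (by positivity)]

/-- The adjunction between raising and lowering decreases both indices together until one is zero.
If the other is still positive, the lowering coefficient √(0/2) kills the integral; otherwise the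
Gaussian integral remains. -/
theorem integral_hermiteFun_mul (n m : ℕ) :
    ∫ x, hermiteFun n x * hermiteFun m x = if n = m then 1 else 0 := by
  induction n generalizing m with
  | zero =>
    cases m with
    | zero => simpa using integral_hermiteFun_zero_sq
    | succ m =>
      have h := sqrt_mul_integral_hermiteFun_succ_mul m 0
      have h0 : √((m + 1 : ℝ) / 2) ≠ 0 := by positivity
      simp only [Nat.cast_zero, zero_div, Real.sqrt_zero, zero_mul, mul_eq_zero, h0, false_or] at h
      simp only [mul_comm (hermiteFun 0 _)]
      simpa using h
  | succ n ih =>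
    have h := sqrt_mul_integral_hermiteFun_succ_mul n m
    have h0 : √((n : ℝ) + 1) ≠ 0 := by positivity
    cases m with
    | zero => simpa [h0] using h
    | succ m =>
      rw [Nat.add_sub_cancel, ih] at h
      by_cases hnm : n = m
      · subst hnm
        have h1 : √((n + 1 : ℝ) / 2) ≠ 0 := by positivity
        simp only [if_true, mul_one, Nat.cast_add, Nat.cast_one] at h
        simpa using mul_left_cancel₀ h1 (h.trans (mul_one _).symm)
      · simpa [h0, hnm] using h

/-- One-dimensional Sobolev argument: h_n(x)² = ∫_{-∞}^x 2 h_n h_n' ≤ ∫ (h_n² + h_n'²). The first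
term contributes 1 and the second at most 2n + 1. Polynomial growth in n is all that matters later.
-/
theorem hermiteFun_sq_le (n : ℕ) (x : ℝ) : hermiteFun n x ^ 2 ≤ 2 * n + 2 := by
  set d : ℝ → ℝ := fun x =>
    √(n / 2) * hermiteFun (n - 1) x - √((n + 1) / 2) * hermiteFun (n + 1) x with hd
  have hd2 : MemLp d 2 := ((memLp_hermiteFun _).const_mul _).sub ((memLp_hermiteFun _).const_mul _)
  have I1 : Integrable fun x => hermiteFun n x ^ 2 := integrable_hermiteFun_sq n
  have I2 : Integrable fun x => d x ^ 2 := hd2.integrable_sq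
  have I3 : Integrable fun x => 2 * hermiteFun n x ^ (2 - 1) * d x := by
    have := ((memLp_hermiteFun n).integrable_mul hd2).const_mul 2
    refine this.congr (.of_forall fun x => ?_)
    simp; ring
  have hder : ∀ x, HasDerivAt (fun x => hermiteFun n x ^ 2) (2 * hermiteFun n x ^ (2 - 1) * d x) x :=
    fun x => (hasDerivAt_hermiteFun n x).pow 2
  have hlim := tendsto_zero_of_hasDerivAt_of_integrableOn_Iic (a := x) (fun y _ => hder y)
    I3.integrableOn I1.integrableOn
  have key := integral_Iic_of_hasDerivAt_of_tendsto' (a := x) (fun y _ => hder y)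
    I3.integrableOn hlim
  rw [sub_zero] at key
  have J1 : ∫ x, hermiteFun n x ^ 2 = 1 := by simpa [pow_two] using integral_hermiteFun_mul n n
  have J2 : ∫ x, d x ^ 2 ≤ 2 * n + 1 := by
    -- From (a - b)² ≤ 2a² + 2b², which avoids the cross term and the special case n = 0.
    have hb : ∀ x, d x ^ 2 ≤ n * (hermiteFun (n - 1) x * hermiteFun (n - 1) x) +
        (n + 1) * (hermiteFun (n + 1) x * hermiteFun (n + 1) x) := by
      intro x
      have s1 := Real.sq_sqrt (show (0 : ℝ) ≤ n / 2 by positivity)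
      have s2 := Real.sq_sqrt (show (0 : ℝ) ≤ (n + 1) / 2 by positivity)
      have := sq_nonneg (√(n / 2) * hermiteFun (n - 1) x + √((n + 1) / 2) * hermiteFun (n + 1) x)
      simp only [hd]
      calc _ ≤ 2 * (√(n / 2) ^ 2 * hermiteFun (n - 1) x ^ 2 +
            √((n + 1) / 2) ^ 2 * hermiteFun (n + 1) x ^ 2) := by linarith
        _ = _ := by rw [s1, s2]; ring
    have I4 := (integrable_hermiteFun_mul (n - 1) (n - 1)).const_mul (n : ℝ)
    have I5 := (integrable_hermiteFun_mul (n + 1) (n + 1)).const_mul (n + 1 : ℝ)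
    refine (integral_mono I2 (I4.add I5) hb).trans ?_
    simp only [Pi.add_apply]
    rw [integral_add I4 I5, integral_const_mul, integral_const_mul, integral_hermiteFun_mul,
      integral_hermiteFun_mul]
    simp
    linarith
  calc hermiteFun n x ^ 2 = ∫ y in Set.Iic x, 2 * hermiteFun n y ^ (2 - 1) * d y := key.symm
    _ ≤ ∫ y in Set.Iic x, (hermiteFun n y ^ 2 + d y ^ 2) := by
      refine setIntegral_mono I3.integrableOn (I1.add I2).integrableOn fun y => ?_
      have := two_mul_le_add_sq (hermiteFun n y) (d y)
      simpa using this
    _ ≤ ∫ y, (hermiteFun n y ^ 2 + d y ^ 2) :=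
      setIntegral_le_integral (I1.add I2) (.of_forall fun y => by positivity)
    _ ≤ 2 * n + 2 := by
      rw [integral_add I1 I2, J1]; linarith

theorem abs_hermiteFun_le (n : ℕ) (x : ℝ) : |hermiteFun n x| ≤ 2 * (n + 1) := by
  have := hermiteFun_sq_le n x
  refine abs_le_of_sq_le_sq (this.trans ?_) (by positivity)
  nlinarith [(Nat.cast_nonneg n : (0 : ℝ) ≤ n)]

theorem contDiff_hermiteFun (n : ℕ) {k : WithTop ℕ∞} : ContDiff ℝ k (hermiteFun n) := by
  unfold hermiteFun
  have : ContDiff ℝ k fun x : ℝ => Polynomial.aeval (√2 * x) (Polynomial.hermite n) :=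
    (Polynomial.contDiff_aeval (Polynomial.hermite n) k).comp (by fun_prop)
  fun_prop

end

end SchwartzOperators

namespace SchwartzOperators

noncomputable section

variable {n : ℕ}

/-! ### Polynomially bounded families -/

/-- The basic weight `∏ i, (γ_i + 1)`. -/
def basicWeight (γ : MultiIndex n) : ℝ := ∏ i, ((γ i : ℝ) + 1)

theorem one_le_basicWeight (γ : MultiIndex n) : 1 ≤ basicWeight γ :=
  Finset.one_le_prod fun i _ => by simp

theorem basicWeight_pos (γ : MultiIndex n) : 0 < basicWeight γ :=
  one_pos.trans_le (one_le_basicWeight γ)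

theorem weight_const (m : ℕ) (γ : MultiIndex n) : weight (fun _ => m) γ = basicWeight γ ^ m :=
  Finset.prod_pow _ _ _

theorem weight_pos (α γ : MultiIndex n) : 0 < weight α γ :=
  Finset.prod_pos fun i _ => by positivity

theorem add_one_le_basicWeight (γ : MultiIndex n) (i : Fin n) : (γ i : ℝ) + 1 ≤ basicWeight γ := by
  rw [basicWeight, ← Finset.mul_prod_erase _ _ (Finset.mem_univ i)]
  exact le_mul_of_one_le_right (by positivity) (Finset.one_le_prod fun i _ => by simp)

/-- The multi-index `γ + e_i`. -/
def raise (γ : MultiIndex n) (i : Fin n) : MultiIndex n := Function.update γ i (γ i + 1)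

/-- The multi-index `γ - e_i`, truncated at zero. -/
def lower (γ : MultiIndex n) (i : Fin n) : MultiIndex n := Function.update γ i (γ i - 1)

theorem basicWeight_update (γ : MultiIndex n) (i : Fin n) (k : ℕ) :
    basicWeight (Function.update γ i k) =
      (k + 1) * ∏ j ∈ Finset.univ.erase i, ((γ j : ℝ) + 1) := by
  rw [basicWeight, ← Finset.mul_prod_erase _ _ (Finset.mem_univ i), Function.update_self]
  congr 1
  refine Finset.prod_congr rfl fun j hj => ?_
  rw [Function.update_of_ne (Finset.ne_of_mem_erase hj)]

theorem basicWeight_eq_mul (γ : MultiIndex n) (i : Fin n) :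
    basicWeight γ = (γ i + 1) * ∏ j ∈ Finset.univ.erase i, ((γ j : ℝ) + 1) := by
  rw [← basicWeight_update, Function.update_eq_self]

theorem basicWeight_raise_le (γ : MultiIndex n) (i : Fin n) :
    basicWeight (raise γ i) ≤ 2 * basicWeight γ := by
  rw [raise, basicWeight_update, basicWeight_eq_mul γ i, ← mul_assoc]
  refine mul_le_mul_of_nonneg_right ?_ (by positivity)
  push_cast
  linarith [(Nat.cast_nonneg (γ i) : (0 : ℝ) ≤ γ i)]

theorem basicWeight_lower_le (γ : MultiIndex n) (i : Fin n) :
    basicWeight (lower γ i) ≤ basicWeight γ := by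
  rw [lower, basicWeight_update, basicWeight_eq_mul γ i]
  refine mul_le_mul_of_nonneg_right ?_ (by positivity)
  gcongr
  exact Nat.sub_le _ _

/-- A family of functions that is bounded uniformly by a polynomial in the multi-index. -/
def IsPolyBounded {X : Type*} (f : MultiIndex n → X → ℝ) : Prop :=
  ∃ (C : ℝ) (m : ℕ), 0 ≤ C ∧ ∀ γ x, f γ x ≤ C * basicWeight γ ^ m

namespace IsPolyBounded

variable {X : Type*} {f g : MultiIndex n → X → ℝ}

theorem mono (hg : IsPolyBounded g) (h : ∀ γ x, f γ x ≤ g γ x) : IsPolyBounded f := by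
  obtain ⟨C, m, hC, hm⟩ := hg
  exact ⟨C, m, hC, fun γ x => (h γ x).trans (hm γ x)⟩

theorem zero : IsPolyBounded (fun _ _ => 0 : MultiIndex n → X → ℝ) :=
  ⟨0, 0, le_rfl, by simp⟩

theorem add (hf : IsPolyBounded f) (hg : IsPolyBounded g) :
    IsPolyBounded fun γ x => f γ x + g γ x := by
  obtain ⟨C, m, hC, hm⟩ := hf
  obtain ⟨D, k, hD, hk⟩ := hg
  refine ⟨C + D, max m k, by positivity, fun γ x => (add_le_add (hm γ x) (hk γ x)).trans ?_⟩
  rw [add_mul]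
  have := one_le_basicWeight γ
  gcongr
  · exact le_max_left _ _
  · exact le_max_right _ _

theorem sum {ι : Type*} (s : Finset ι) {F : ι → MultiIndex n → X → ℝ}
    (h : ∀ i ∈ s, IsPolyBounded (F i)) : IsPolyBounded fun γ x => ∑ i ∈ s, F i γ x := by
  classical
  induction s using Finset.induction_on with
  | empty => simpa using zero
  | insert i s hi ih =>
    simp only [Finset.sum_insert hi]
    exact (h i (Finset.mem_insert_self _ _)).add
      (ih fun j hj => h j (Finset.mem_insert_of_mem hj))

theorem const_mul (hf : IsPolyBounded f) {c : ℝ} (hc : 0 ≤ c) :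
    IsPolyBounded fun γ x => c * f γ x := by
  obtain ⟨C, m, hC, hm⟩ := hf
  refine ⟨c * C, m, by positivity, fun γ x => ?_⟩
  rw [mul_assoc]
  exact mul_le_mul_of_nonneg_left (hm γ x) hc

theorem coeff_mul (hf : IsPolyBounded f) {c : MultiIndex n → ℝ} (hc : ∀ γ, 0 ≤ c γ)
    (hc' : ∀ γ, c γ ≤ basicWeight γ) : IsPolyBounded fun γ x => c γ * f γ x := by
  obtain ⟨C, m, hC, hm⟩ := hf
  refine ⟨C, m + 1, hC, fun γ x => ?_⟩
  have := basicWeight_pos γ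
  calc c γ * f γ x ≤ basicWeight γ * (C * basicWeight γ ^ m) := by
        refine (mul_le_mul_of_nonneg_left (hm γ x) (hc γ)).trans ?_
        exact mul_le_mul_of_nonneg_right (hc' γ) (by positivity)
    _ = _ := by ring

/-- A raising step at most doubles the weight, so the class is stable under ladder shifts; this
drives the inductions below. -/
theorem comp_raise (hf : IsPolyBounded f) (i : Fin n) : IsPolyBounded fun γ => f (raise γ i) := by
  obtain ⟨C, m, hC, hm⟩ := hf
  refine ⟨C * 2 ^ m, m, by positivity, fun γ x => (hm _ x).trans ?_⟩
  rw [mul_assoc, ← mul_pow]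
  have := basicWeight_pos (raise γ i)
  gcongr
  exact basicWeight_raise_le γ i

theorem comp_lower (hf : IsPolyBounded f) (i : Fin n) : IsPolyBounded fun γ => f (lower γ i) := by
  obtain ⟨C, m, hC, hm⟩ := hf
  refine ⟨C, m, hC, fun γ x => (hm _ x).trans ?_⟩
  have := basicWeight_pos (lower γ i)
  gcongr
  exact basicWeight_lower_le γ i

end IsPolyBounded

/-! ### The Hermite functions of several variables -/

/-- The coefficient of the raising operator. -/
def upCoeff (γ : MultiIndex n) (i : Fin n) : ℝ := √((γ i + 1) / 2)

/-- The coefficient of the lowering operator. -/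
def downCoeff (γ : MultiIndex n) (i : Fin n) : ℝ := √(γ i / 2)

theorem upCoeff_nonneg (γ : MultiIndex n) (i : Fin n) : 0 ≤ upCoeff γ i := Real.sqrt_nonneg _

theorem downCoeff_nonneg (γ : MultiIndex n) (i : Fin n) : 0 ≤ downCoeff γ i := Real.sqrt_nonneg _

theorem upCoeff_le (γ : MultiIndex n) (i : Fin n) : upCoeff γ i ≤ basicWeight γ := by
  refine le_trans ?_ (add_one_le_basicWeight γ i)
  have : (0 : ℝ) ≤ γ i := Nat.cast_nonneg _
  exact Real.sqrt_le_iff.2 ⟨by positivity, by nlinarith⟩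

theorem downCoeff_le (γ : MultiIndex n) (i : Fin n) : downCoeff γ i ≤ basicWeight γ := by
  refine le_trans (Real.sqrt_le_sqrt ?_) (upCoeff_le γ i)
  gcongr
  linarith

theorem numberFun_update (γ : MultiIndex n) (i : Fin n) (k : ℕ) (q : Conf n) :
    numberFun (Function.update γ i k) q =
      ((hermiteFun k (q i) * ∏ j ∈ Finset.univ.erase i, hermiteFun (γ j) (q j) : ℝ) : ℂ) := by
  rw [numberFun, ← Finset.mul_prod_erase _ _ (Finset.mem_univ i), Function.update_self]
  congr 2
  refine Finset.prod_congr rfl fun j hj => ?_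
  rw [Function.update_of_ne (Finset.ne_of_mem_erase hj)]

theorem numberFun_eq_mul (γ : MultiIndex n) (i : Fin n) (q : Conf n) :
    numberFun γ q =
      ((hermiteFun (γ i) (q i) * ∏ j ∈ Finset.univ.erase i, hermiteFun (γ j) (q j) : ℝ) : ℂ) := by
  rw [← numberFun_update, Function.update_eq_self]

theorem coord_mul_numberFun (γ : MultiIndex n) (i : Fin n) (q : Conf n) :
    (q i : ℂ) * numberFun γ q = upCoeff γ i * numberFun (raise γ i) q +
      downCoeff γ i * numberFun (lower γ i) q := by
  rw [raise, lower, numberFun_update, numberFun_update, numberFun_eq_mul γ i]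
  have := mul_hermiteFun (γ i) (q i)
  simp only [upCoeff, downCoeff]
  norm_cast
  rw [← mul_assoc, this]
  push_cast
  ring

/-- The partial derivative of the function `|γ⟩`. -/
def partialNumberFun (γ : MultiIndex n) (i : Fin n) (q : Conf n) : ℂ :=
  downCoeff γ i * numberFun (lower γ i) q - upCoeff γ i * numberFun (raise γ i) q

/-- The complex covector `v ↦ v_i z`. -/
def covector (i : Fin n) : ℂ →L[ℝ] Conf n →L[ℝ] ℂ :=
  ContinuousLinearMap.smulRightL ℝ (Conf n) ℂ (EuclideanSpace.proj i : Conf n →L[ℝ] ℝ)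

theorem covector_apply (i : Fin n) (z : ℂ) (v : Conf n) : covector i z v = (v i : ℂ) * z := by
  simp [covector]

/-- Expressing the derivative through shifted number functions lets higher derivatives be handled
without leaving the family. -/
theorem hasFDerivAt_numberFun (γ : MultiIndex n) (q : Conf n) :
    HasFDerivAt (numberFun γ) (∑ i, covector i (partialNumberFun γ i q)) q := by
  have h1 : ∀ i ∈ (Finset.univ : Finset (Fin n)), HasFDerivAt
      (hermiteFun (γ i) ∘ (EuclideanSpace.proj i : Conf n →L[ℝ] ℝ)) ((√(γ i / 2) * hermiteFun (γ i - 1) (q i) -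
        √((γ i + 1) / 2) * hermiteFun (γ i + 1) (q i)) •
        (EuclideanSpace.proj i : Conf n →L[ℝ] ℝ)) q := fun i _ =>
    (hasDerivAt_hermiteFun (γ i) (q i)).comp_hasFDerivAt q
      (EuclideanSpace.proj i : Conf n →L[ℝ] ℝ).hasFDerivAt
  have h2 := Complex.ofRealCLM.hasFDerivAt.comp q (HasFDerivAt.finsetProd h1)
  have e : numberFun γ = Complex.ofRealCLM ∘ fun q : Conf n => ∏ i, hermiteFun (γ i) (q i) := rfl
  rw [e]
  have hp : ∀ (i : Fin n) (w : Conf n), (EuclideanSpace.proj i : Conf n →L[ℝ] ℝ) w = w i :=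
    fun _ _ => rfl
  convert! h2 using 1
  · ext v
    simp only [covector_apply, partialNumberFun, numberFun_update, raise, lower, upCoeff,
      downCoeff, ContinuousLinearMap.comp_apply, _root_.sum_apply, _root_.smul_apply, map_sum,
      Complex.ofRealCLM_apply, smul_eq_mul, Function.comp, hp]
    push_cast
    refine Finset.sum_congr rfl fun i _ => ?_
    ring

theorem contDiff_numberFun (γ : MultiIndex n) {k : WithTop ℕ∞} : ContDiff ℝ k (numberFun γ) := by
  have : ContDiff ℝ k fun q : Conf n => ∏ i, hermiteFun (γ i) (q i) :=
    contDiff_prod fun i _ => (contDiff_hermiteFun (γ i)).comp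
      (EuclideanSpace.proj i : Conf n →L[ℝ] ℝ).contDiff
  exact Complex.ofRealCLM.contDiff.comp this

theorem contDiff_partialNumberFun (γ : MultiIndex n) (i : Fin n) {k : WithTop ℕ∞} :
    ContDiff ℝ k (partialNumberFun γ i) :=
  (contDiff_const.mul (contDiff_numberFun _)).sub (contDiff_const.mul (contDiff_numberFun _))

theorem fderiv_numberFun (γ : MultiIndex n) :
    fderiv ℝ (numberFun γ) = fun q => ∑ i, (covector i ∘ partialNumberFun γ i) q :=
  funext fun q => (hasFDerivAt_numberFun γ q).fderiv

theorem norm_iteratedFDeriv_partialNumberFun_le (l : ℕ) (γ : MultiIndex n) (i : Fin n)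
    (q : Conf n) : ‖iteratedFDeriv ℝ l (partialNumberFun γ i) q‖ ≤
      downCoeff γ i * ‖iteratedFDeriv ℝ l (numberFun (lower γ i)) q‖ +
        upCoeff γ i * ‖iteratedFDeriv ℝ l (numberFun (raise γ i)) q‖ := by
  have e : partialNumberFun γ i =
      (downCoeff γ i : ℂ) • numberFun (lower γ i) - (upCoeff γ i : ℂ) • numberFun (raise γ i) := rfl
  have hc : ∀ (c : ℂ) (δ : MultiIndex n), ContDiffAt ℝ l (c • numberFun δ) q := fun c δ =>
    ((contDiff_numberFun δ).const_smul c).contDiffAt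
  rw [e, iteratedFDeriv_sub_apply (hc _ _) (hc _ _),
    iteratedFDeriv_const_smul_apply (contDiff_numberFun _).contDiffAt,
    iteratedFDeriv_const_smul_apply (contDiff_numberFun _).contDiffAt]
  refine (norm_sub_le _ _).trans_eq ?_
  rw [norm_smul, norm_smul, Complex.norm_real, Complex.norm_real, Real.norm_of_nonneg
    (downCoeff_nonneg _ _), Real.norm_of_nonneg (upCoeff_nonneg _ _)]

theorem norm_le_sum_abs_coord (q : Conf n) : ‖q‖ ≤ ∑ i, |q i| := by
  rw [EuclideanSpace.norm_eq]
  refine Real.sqrt_le_iff.2 ⟨by positivity, ?_⟩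
  exact Finset.sum_sq_le_sq_sum_of_nonneg fun i _ => norm_nonneg _

theorem norm_numberFun_le (γ : MultiIndex n) (q : Conf n) :
    ‖numberFun γ q‖ ≤ 2 ^ n * basicWeight γ := by
  rw [numberFun, Complex.norm_real, norm_prod]
  refine (Finset.prod_le_prod (fun i _ => norm_nonneg _)
    fun i _ => abs_hermiteFun_le (γ i) (q i)).trans_eq ?_
  simp [Finset.prod_mul_distrib, basicWeight]

/-- One factor ‖q‖ is bounded by ∑ |q_i|, and each q_i acts on |γ⟩ as a sum of two shifts with
polynomially bounded coefficients. The induction starts from the uniform bound on h_n. -/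
theorem isPolyBounded_norm_pow_mul_numberFun (k : ℕ) :
    IsPolyBounded fun (γ : MultiIndex n) (q : Conf n) => ‖q‖ ^ k * ‖numberFun γ q‖ := by
  induction k with
  | zero => exact ⟨2 ^ n, 1, by positivity, fun γ q => by simpa using norm_numberFun_le γ q⟩
  | succ k ih =>
    have h : IsPolyBounded fun (γ : MultiIndex n) (q : Conf n) => ∑ i,
        (upCoeff γ i * (‖q‖ ^ k * ‖numberFun (raise γ i) q‖) +
          downCoeff γ i * (‖q‖ ^ k * ‖numberFun (lower γ i) q‖)) :=
      IsPolyBounded.sum _ fun i _ =>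
        ((ih.comp_raise i).coeff_mul (upCoeff_nonneg · i) (upCoeff_le · i)).add
          ((ih.comp_lower i).coeff_mul (downCoeff_nonneg · i) (downCoeff_le · i))
    refine h.mono fun γ q => ?_
    calc ‖q‖ ^ (k + 1) * ‖numberFun γ q‖ ≤ ‖q‖ ^ k * ((∑ i, |q i|) * ‖numberFun γ q‖) := by
          rw [pow_succ, mul_assoc]
          gcongr
          exact norm_le_sum_abs_coord q
      _ = ∑ i, ‖q‖ ^ k * ‖(q i : ℂ) * numberFun γ q‖ := by
          rw [Finset.sum_mul, Finset.mul_sum]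
          simp
      _ ≤ _ := by
          refine Finset.sum_le_sum fun i _ => ?_
          rw [coord_mul_numberFun]
          refine (mul_le_mul_of_nonneg_left (norm_add_le _ _) (by positivity)).trans_eq ?_
          rw [norm_mul, norm_mul, Complex.norm_real, Complex.norm_real, Real.norm_of_nonneg
            (downCoeff_nonneg _ _), Real.norm_of_nonneg (upCoeff_nonneg _ _)]
          ring

/-- The derivative of order l + 1 is the l-th derivative of the gradient, a sum of fixed covectors
times shifted number functions. The family index is quantified inside the bound, so the induction
hypothesis applies to the shifts. -/
theorem isPolyBounded_norm_pow_mul_iteratedFDeriv_numberFun (k l : ℕ) :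
    IsPolyBounded fun (γ : MultiIndex n) (q : Conf n) =>
      ‖q‖ ^ k * ‖iteratedFDeriv ℝ l (numberFun γ) q‖ := by
  induction l with
  | zero => simpa using isPolyBounded_norm_pow_mul_numberFun k
  | succ l ih =>
    have h : IsPolyBounded fun (γ : MultiIndex n) (q : Conf n) => ∑ i, ‖covector (n := n) i‖ *
        (downCoeff γ i * (‖q‖ ^ k * ‖iteratedFDeriv ℝ l (numberFun (lower γ i)) q‖) +
        upCoeff γ i * (‖q‖ ^ k * ‖iteratedFDeriv ℝ l (numberFun (raise γ i)) q‖)) :=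
      IsPolyBounded.sum _ fun i _ => IsPolyBounded.const_mul
        (((ih.comp_lower i).coeff_mul (downCoeff_nonneg · i) (downCoeff_le · i)).add
          ((ih.comp_raise i).coeff_mul (upCoeff_nonneg · i) (upCoeff_le · i))) (norm_nonneg (covector i))
    refine h.mono fun γ q => ?_
    have hc : ∀ i, ContDiff ℝ l (covector i ∘ partialNumberFun γ i) := fun i =>
      (covector i).contDiff.comp (contDiff_partialNumberFun γ i)
    rw [← norm_iteratedFDeriv_fderiv, fderiv_numberFun,
      iteratedFDeriv_fun_sum_apply fun i _ => (hc i).contDiffAt]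
    calc _ ≤ ‖q‖ ^ k * ∑ i, ‖covector (n := n) i‖ *
            (downCoeff γ i * ‖iteratedFDeriv ℝ l (numberFun (lower γ i)) q‖ +
            upCoeff γ i * ‖iteratedFDeriv ℝ l (numberFun (raise γ i)) q‖) := by
          refine mul_le_mul_of_nonneg_left ((norm_sum_le _ _).trans
            (Finset.sum_le_sum fun i _ => ?_)) (by positivity)
          refine ((covector i).norm_iteratedFDeriv_comp_left
            (contDiff_partialNumberFun γ i (k := l)).contDiffAt le_rfl).trans ?_
          exact mul_le_mul_of_nonneg_left (norm_iteratedFDeriv_partialNumberFun_le l γ i q)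
            (norm_nonneg _)
      _ = _ := by
          rw [Finset.mul_sum]
          refine Finset.sum_congr rfl fun i _ => ?_
          ring

/-- The number basis function `|γ⟩` as a Schwartz function. -/
def numberSchwartz (γ : MultiIndex n) : 𝓢(Conf n, ℂ) where
  toFun := numberFun γ
  smooth' := contDiff_numberFun γ
  decay' k l := by
    obtain ⟨C, m, -, h⟩ := isPolyBounded_norm_pow_mul_iteratedFDeriv_numberFun (n := n) k l
    exact ⟨C * basicWeight γ ^ m, h γ⟩

theorem numberSchwartz_apply (γ : MultiIndex n) (q : Conf n) :
    numberSchwartz γ q = numberFun γ q := rfl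

theorem exists_seminorm_numberSchwartz_le (k l : ℕ) : ∃ (C : ℝ) (m : ℕ), 0 ≤ C ∧
    ∀ γ : MultiIndex n, SchwartzMap.seminorm ℂ k l (numberSchwartz γ) ≤ C * basicWeight γ ^ m := by
  obtain ⟨C, m, hC, h⟩ := isPolyBounded_norm_pow_mul_iteratedFDeriv_numberFun (n := n) k l
  have := basicWeight_pos (n := n)
  exact ⟨C, m, hC, fun γ => SchwartzMap.seminorm_le_bound _ _ _ _
    (mul_nonneg hC (pow_nonneg (this γ).le _)) (h γ)⟩

/-- Continuity dominates the norm of the image by finitely many Schwartz seminorms, each of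
polynomial growth on the number basis. It will be applied to formal adjoints of P^β Q^α followed by
the inclusion into L². -/
theorem exists_norm_map_numberSchwartz_le {F : Type*} [NormedAddCommGroup F] [NormedSpace ℂ F]
    (A : 𝓢(Conf n, ℂ) →L[ℂ] F) : ∃ (C : ℝ) (m : ℕ), 0 ≤ C ∧
    ∀ γ : MultiIndex n, ‖A (numberSchwartz γ)‖ ≤ C * basicWeight γ ^ m := by
  obtain ⟨s, C, -, h⟩ := Seminorm.bound_of_continuous (schwartz_withSeminorms ℂ (Conf n) ℂ)
    ((normSeminorm ℂ F).comp (A : 𝓢(Conf n, ℂ) →ₗ[ℂ] F)) (continuous_norm.comp A.continuous)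
  have hs : IsPolyBounded fun (γ : MultiIndex n) (_ : Unit) =>
      C * ∑ i ∈ s, schwartzSeminormFamily ℂ (Conf n) ℂ i (numberSchwartz γ) := by
    refine IsPolyBounded.const_mul (IsPolyBounded.sum _ fun i _ => ?_) C.2
    obtain ⟨C, m, hC, h⟩ := exists_seminorm_numberSchwartz_le (n := n) i.1 i.2
    exact ⟨C, m, hC, fun γ _ => h γ⟩
  obtain ⟨D, m, hD, hm⟩ := hs
  refine ⟨D, m, hD, fun γ => le_trans ?_ (hm γ ())⟩
  refine (h (numberSchwartz γ)).trans ?_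
  rw [_root_.smul_apply, NNReal.smul_def, smul_eq_mul]
  refine mul_le_mul_of_nonneg_left ?_ C.2
  refine (Seminorm.finset_sup_le_sum _ _ _).trans_eq ?_
  rw [_root_.sum_apply]

end

end SchwartzOperators

namespace SchwartzOperators

noncomputable section

variable {n : ℕ}

/-! ### Formal adjoints -/

theorem inner_toLp_toLp (f g : 𝓢(Conf n, ℂ)) :
    inner ℂ (f.toLp 2 volume) (g.toLp 2 volume) = ∫ q, inner ℂ (f q) (g q) :=
  SchwartzMap.inner_toL2_toL2_eq f g volume

/-- `B` is a formal adjoint of `A` with respect to the `L²` scalar product. -/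
def IsFormalAdjoint (A B : 𝓢(Conf n, ℂ) →L[ℂ] 𝓢(Conf n, ℂ)) : Prop :=
  ∀ f g : 𝓢(Conf n, ℂ), inner ℂ ((A f).toLp 2 volume) (g.toLp 2 volume) =
    inner ℂ (f.toLp 2 volume) ((B g).toLp 2 volume)

theorem IsFormalAdjoint.mul {A B A' B' : 𝓢(Conf n, ℂ) →L[ℂ] 𝓢(Conf n, ℂ)}
    (h : IsFormalAdjoint A B) (h' : IsFormalAdjoint A' B') :
    IsFormalAdjoint (A * A') (B' * B) := fun f g => by
  rw [mul_apply_eq_comp, mul_apply_eq_comp, h, h']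

theorem IsFormalAdjoint.one : IsFormalAdjoint (1 : 𝓢(Conf n, ℂ) →L[ℂ] 𝓢(Conf n, ℂ)) 1 :=
  fun _ _ => rfl

theorem IsFormalAdjoint.add {A B A' B' : 𝓢(Conf n, ℂ) →L[ℂ] 𝓢(Conf n, ℂ)}
    (h : IsFormalAdjoint A B) (h' : IsFormalAdjoint A' B') :
    IsFormalAdjoint (A + A') (B + B') := fun f g => by
  have e : ∀ f g : 𝓢(Conf n, ℂ), (f + g).toLp 2 volume = f.toLp 2 volume + g.toLp 2 volume :=
    (SchwartzMap.toLpCLM ℂ ℂ 2 (volume : Measure (Conf n))).map_add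
  rw [_root_.add_apply, _root_.add_apply, e, e, inner_add_left, inner_add_right, h, h']

theorem IsFormalAdjoint.pow {A B : 𝓢(Conf n, ℂ) →L[ℂ] 𝓢(Conf n, ℂ)}
    (h : IsFormalAdjoint A B) (k : ℕ) : IsFormalAdjoint (A ^ k) (B ^ k) := by
  induction k with
  | zero => simpa using IsFormalAdjoint.one
  | succ k ih =>
    rw [pow_succ, pow_succ']
    exact ih.mul h

theorem IsFormalAdjoint.list_prod {l : List (𝓢(Conf n, ℂ) →L[ℂ] 𝓢(Conf n, ℂ))}
    (h : ∀ A ∈ l, ∃ B, IsFormalAdjoint A B) : ∃ B, IsFormalAdjoint l.prod B := by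
  induction l with
  | nil => exact ⟨1, by simpa using IsFormalAdjoint.one⟩
  | cons A l ih =>
    obtain ⟨B, hB⟩ := h A List.mem_cons_self
    obtain ⟨B', hB'⟩ := ih fun A' hA' => h A' (List.mem_cons_of_mem _ hA')
    exact ⟨B' * B, by simpa using hB.mul hB'⟩

theorem isFormalAdjoint_positionOp (i : Fin n) :
    IsFormalAdjoint (positionOp n i) (positionOp n i) := fun f g => by
  rw [inner_toLp_toLp, inner_toLp_toLp]
  congr 1
  ext q
  simp only [positionOp_apply, RCLike.inner_apply, map_mul, Complex.conj_ofReal]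
  ring

/-- The sign from integration by parts cancels the sign from conjugating -i. -/
theorem isFormalAdjoint_momentumOp (i : Fin n) :
    IsFormalAdjoint (momentumOp n i) (momentumOp n i) := fun f g => by
  rw [inner_toLp_toLp, inner_toLp_toLp]
  have key := SchwartzMap.integral_bilinear_lineDerivOp_right_eq_neg_left (μ := volume) f g
    ((ContinuousLinearMap.mul ℝ ℂ).comp (Complex.conjCLE : ℂ →L[ℝ] ℂ))
    (EuclideanSpace.single i (1 : ℝ))
  have e : ∀ (f : 𝓢(Conf n, ℂ)) (q : Conf n), momentumOp n i f q =
      -Complex.I * (∂_{EuclideanSpace.single i (1 : ℝ)} f) q := fun f q => by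
    simp [momentumOp]
  simp only [ContinuousLinearMap.comp_apply, ContinuousLinearMap.mul_apply',
    ContinuousLinearEquiv.coe_coe, Complex.conjCLE_apply] at key
  simp only [e, RCLike.inner_apply, map_mul, map_neg, Complex.conj_I, neg_neg]
  calc _ = Complex.I * ∫ q, (starRingEnd ℂ) ((∂_{EuclideanSpace.single i (1 : ℝ)} f) q) * g q := by
        rw [← integral_const_mul]; congr 1; ext q; ring
    _ = -Complex.I *
        ∫ q, (starRingEnd ℂ) (f q) * (∂_{EuclideanSpace.single i (1 : ℝ)} g) q := by
        rw [key]; ring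
    _ = _ := by rw [← integral_const_mul]; congr 1; ext q; ring

theorem exists_isFormalAdjoint_opPow {A : Fin n → (𝓢(Conf n, ℂ) →L[ℂ] 𝓢(Conf n, ℂ))}
    (h : ∀ i, IsFormalAdjoint (A i) (A i)) (α : MultiIndex n) :
    ∃ B, IsFormalAdjoint (opPow A α) B := by
  refine IsFormalAdjoint.list_prod fun C hC => ?_
  obtain ⟨i, rfl⟩ := (List.mem_ofFn' _ _).1 hC
  exact ⟨_, (h i).pow _⟩

/-! ### Action of position, momentum and number operators on the number basis -/

theorem positionOp_numberSchwartz (γ : MultiIndex n) (i : Fin n) :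
    positionOp n i (numberSchwartz γ) = (upCoeff γ i : ℂ) • numberSchwartz (raise γ i) +
      (downCoeff γ i : ℂ) • numberSchwartz (lower γ i) := by
  ext q
  simpa [positionOp_apply, numberSchwartz_apply] using coord_mul_numberFun γ i q

theorem momentumOp_numberSchwartz (γ : MultiIndex n) (i : Fin n) :
    momentumOp n i (numberSchwartz γ) = (Complex.I * upCoeff γ i) • numberSchwartz (raise γ i) -
      (Complex.I * downCoeff γ i) • numberSchwartz (lower γ i) := by
  ext q
  have h : lineDeriv ℝ (numberSchwartz γ : Conf n → ℂ) q (EuclideanSpace.single i (1 : ℝ)) =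
      partialNumberFun γ i q := by
    have h1 := (hasFDerivAt_numberFun γ q).hasLineDerivAt (EuclideanSpace.single i (1 : ℝ))
    have h2 := h1.lineDeriv
    refine h2.trans ?_
    simp [covector_apply, apply_ite Complex.ofReal]
  rw [momentumOp_apply, h, partialNumberFun]
  simp [numberSchwartz_apply]
  ring

/-- The (rescaled) number operator `P_i² + Q_i²` of the `i`-th degree of freedom. -/
def numberOp (n : ℕ) (i : Fin n) : 𝓢(Conf n, ℂ) →L[ℂ] 𝓢(Conf n, ℂ) :=
  momentumOp n i * momentumOp n i + positionOp n i * positionOp n i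

theorem raise_lower (γ : MultiIndex n) (i : Fin n) (h : γ i ≠ 0) : raise (lower γ i) i = γ := by
  ext j
  by_cases hj : j = i
  · subst hj
    simp [raise, lower]
    omega
  · simp [raise, lower, hj]

theorem lower_raise (γ : MultiIndex n) (i : Fin n) : lower (raise γ i) i = γ := by
  simp [raise, lower]

theorem raise_apply_self (γ : MultiIndex n) (i : Fin n) : raise γ i i = γ i + 1 := by simp [raise]

theorem downCoeff_raise (γ : MultiIndex n) (i : Fin n) :
    downCoeff (raise γ i) i = upCoeff γ i := by
  simp [downCoeff, upCoeff, raise_apply_self]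

theorem downCoeff_eq_zero {γ : MultiIndex n} {i : Fin n} (h : γ i = 0) : downCoeff γ i = 0 := by
  simp [downCoeff, h]

theorem upCoeff_lower (γ : MultiIndex n) (i : Fin n) (h : γ i ≠ 0) :
    upCoeff (lower γ i) i = downCoeff γ i := by
  rw [← downCoeff_raise, raise_lower γ i h]

theorem upCoeff_sq (γ : MultiIndex n) (i : Fin n) : upCoeff γ i * upCoeff γ i = (γ i + 1) / 2 :=
  Real.mul_self_sqrt (by positivity)

theorem downCoeff_sq (γ : MultiIndex n) (i : Fin n) : downCoeff γ i * downCoeff γ i = γ i / 2 :=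
  Real.mul_self_sqrt (by positivity)

/-- For γ_i = 0 lowering is truncated and raising does not undo it, but the lowering coefficient is
then zero, so the formula needs no case distinction. -/
theorem downCoeff_smul_raise_lower (γ : MultiIndex n) (i : Fin n) :
    ((downCoeff γ i * upCoeff (lower γ i) i : ℝ) : ℂ) • numberSchwartz (raise (lower γ i) i) =
      ((γ i / 2 : ℝ) : ℂ) • numberSchwartz γ := by
  by_cases h : γ i = 0
  · simp [downCoeff_eq_zero h, h]
  · rw [raise_lower γ i h, upCoeff_lower γ i h, downCoeff_sq]

theorem numberOp_numberSchwartz (γ : MultiIndex n) (i : Fin n) :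
    numberOp n i (numberSchwartz γ) = (2 * (γ i : ℂ) + 1) • numberSchwartz γ := by
  have h1 := downCoeff_smul_raise_lower γ i
  have h2 : ((upCoeff γ i * upCoeff γ i : ℝ) : ℂ) = (γ i + 1) / 2 := by
    rw [upCoeff_sq]; push_cast; ring
  simp only [numberOp, _root_.add_apply, mul_apply_eq_comp, positionOp_numberSchwartz,
    momentumOp_numberSchwartz, map_add, map_sub, map_smul, lower_raise, downCoeff_raise]
  have e : ((2 * (γ i : ℂ) + 1) • numberSchwartz γ : 𝓢(Conf n, ℂ)) =
      ((2 : ℂ) * ((upCoeff γ i * upCoeff γ i : ℝ) : ℂ)) • numberSchwartz γ +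
        (2 : ℂ) • (((γ i / 2 : ℝ) : ℂ) • numberSchwartz γ) := by
    rw [h2, smul_smul, ← add_smul]
    congr 1
    push_cast
    ring
  rw [e, ← h1]
  ext q
  simp only [_root_.add_apply, _root_.sub_apply, _root_.smul_apply, smul_eq_mul]
  push_cast
  -- The bracket is the coefficient of i² in P_i²|γ⟩. With i² = -1 the double shifts cancel against
  -- those of Q_i² and the diagonal terms add up.
  linear_combination (Complex.I_sq : Complex.I ^ 2 = -1) * (
    upCoeff γ i * upCoeff (raise γ i) i * numberSchwartz (raise (raise γ i) i) q
    - upCoeff γ i * upCoeff γ i * numberSchwartz γ q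
    - downCoeff γ i * upCoeff (lower γ i) i * numberSchwartz (raise (lower γ i) i) q
    + downCoeff γ i * downCoeff (lower γ i) i * numberSchwartz (lower (lower γ i) i) q)

theorem isFormalAdjoint_numberOp (i : Fin n) : IsFormalAdjoint (numberOp n i) (numberOp n i) :=
  ((isFormalAdjoint_momentumOp i).mul (isFormalAdjoint_momentumOp i)).add
    ((isFormalAdjoint_positionOp i).mul (isFormalAdjoint_positionOp i))

theorem numberOp_pow_numberSchwartz (γ : MultiIndex n) (i : Fin n) (k : ℕ) :
    (numberOp n i ^ k) (numberSchwartz γ) = ((2 * (γ i : ℂ) + 1) ^ k) • numberSchwartz γ := by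
  induction k with
  | zero => simp
  | succ k ih =>
    rw [pow_succ, mul_apply_eq_comp, numberOp_numberSchwartz, map_smul, ih, smul_smul,
      pow_succ']

theorem opPow_numberOp_numberSchwartz (α γ : MultiIndex n) :
    opPow (numberOp n) α (numberSchwartz γ) =
      (∏ i, (2 * (γ i : ℂ) + 1) ^ α i) • numberSchwartz γ := by
  have h : ∀ l : List (Fin n), (l.map fun i => numberOp n i ^ α i).prod (numberSchwartz γ) =
      (l.map fun i => (2 * (γ i : ℂ) + 1) ^ α i).prod • numberSchwartz γ := by
    intro l
    induction l with
    | nil => simp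
    | cons i l ih =>
      simp only [List.map_cons, List.prod_cons, mul_apply_eq_comp, ih, map_smul,
        numberOp_pow_numberSchwartz, smul_smul]
      rw [mul_comm]
  have := h (List.finRange n)
  rw [← List.ofFn_eq_map, ← List.ofFn_eq_map, List.prod_ofFn] at this
  exact this

/-! ### Orthonormality -/

theorem toLp_numberSchwartz (γ : MultiIndex n) :
    (numberSchwartz γ).toLp 2 volume = numberState γ := rfl

theorem orthonormal_numberState : Orthonormal ℂ (numberState : MultiIndex n → HSpace n) := by
  rw [orthonormal_iff_ite]
  intro γ δ
  rw [← toLp_numberSchwartz, ← toLp_numberSchwartz, inner_toLp_toLp]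
  have h : ∀ q : Conf n, inner ℂ (numberSchwartz γ q) (numberSchwartz δ q) =
      ((∏ i, (hermiteFun (γ i) (q i) * hermiteFun (δ i) (q i)) : ℝ) : ℂ) := by
    intro q
    simp [numberSchwartz_apply, numberFun, Finset.prod_mul_distrib, mul_comm]
  simp only [h]
  rw [integral_complex_ofReal]
  have e := (PiLp.volume_preserving_ofLp (Fin n)).integral_comp
    (MeasurableEquiv.toLp 2 (Fin n → ℝ)).symm.measurableEmbedding
    (fun x : Fin n → ℝ => ∏ i, (hermiteFun (γ i) (x i) * hermiteFun (δ i) (x i)))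
  have e2 : (∫ q : Conf n, ∏ i, (hermiteFun (γ i) (q i) * hermiteFun (δ i) (q i))) =
      ∏ i, (if γ i = δ i then 1 else 0) := by
    refine Eq.trans e ?_
    rw [integral_fintype_prod_volume_eq_prod
      (fun i x => hermiteFun (γ i) x * hermiteFun (δ i) x)]
    simp only [integral_hermiteFun_mul]
  rw [e2, Finset.prod_ite_zero]
  by_cases hγ : γ = δ
  · simp [hγ]
  · simpa [hγ] using Function.ne_iff.1 hγ

end

end SchwartzOperators

namespace SchwartzOperators

noncomputable section

variable {n : ℕ}

/-! ### Completeness of the number basis -/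

/-- The span of the number basis in the Schwartz space. -/
def numberSpan (n : ℕ) : Submodule ℂ 𝓢(Conf n, ℂ) := Submodule.span ℂ (Set.range numberSchwartz)

theorem positionOp_mem_numberSpan (i : Fin n) {f : 𝓢(Conf n, ℂ)} (hf : f ∈ numberSpan n) :
    positionOp n i f ∈ numberSpan n := by
  induction hf using Submodule.span_induction with
  | mem f hf =>
    obtain ⟨γ, rfl⟩ := hf
    rw [positionOp_numberSchwartz]
    exact Submodule.add_mem _ (Submodule.smul_mem _ _ (Submodule.subset_span ⟨_, rfl⟩))
      (Submodule.smul_mem _ _ (Submodule.subset_span ⟨_, rfl⟩))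
  | zero => simp
  | add f g _ _ hf hg => rw [map_add]; exact Submodule.add_mem _ hf hg
  | smul c f _ hf => rw [map_smul]; exact Submodule.smul_mem _ _ hf

/-- Multiplication by `q ↦ ⟨ξ, q⟩` as an operator on Schwartz functions. -/
def linearOp (ξ : Conf n) : 𝓢(Conf n, ℂ) →L[ℂ] 𝓢(Conf n, ℂ) := ∑ i, (ξ i : ℂ) • positionOp n i

theorem linearOp_apply (ξ : Conf n) (f : 𝓢(Conf n, ℂ)) (q : Conf n) :
    linearOp ξ f q = (inner ℝ ξ q : ℝ) * f q := by
  have : linearOp ξ f = ∑ i, (ξ i : ℂ) • positionOp n i f := by simp [linearOp]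
  rw [this, _root_.sum_apply, PiLp.inner_apply]
  push_cast
  rw [Finset.sum_mul]
  refine Finset.sum_congr rfl fun i _ => ?_
  simp [positionOp_apply]
  ring

theorem linearOp_pow_apply (ξ : Conf n) (k : ℕ) (f : 𝓢(Conf n, ℂ)) (q : Conf n) :
    (linearOp ξ ^ k) f q = ((inner ℝ ξ q : ℝ) : ℂ) ^ k * f q := by
  induction k with
  | zero => simp
  | succ k ih =>
    rw [pow_succ', mul_apply_eq_comp, linearOp_apply, ih]
    ring

theorem linearOp_pow_mem_numberSpan (ξ : Conf n) (k : ℕ) {f : 𝓢(Conf n, ℂ)}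
    (hf : f ∈ numberSpan n) : (linearOp ξ ^ k) f ∈ numberSpan n := by
  induction k with
  | zero => simpa
  | succ k ih =>
    rw [pow_succ', mul_apply_eq_comp, linearOp, _root_.sum_apply]
    refine Submodule.sum_mem _ fun i _ => ?_
    rw [_root_.smul_apply]
    exact Submodule.smul_mem _ _ (positionOp_mem_numberSpan i ih)

theorem inner_toLp_eq_zero_of_mem_numberSpan {f : HSpace n}
    (hf : ∀ γ, inner ℂ (numberState γ) f = 0) {g : 𝓢(Conf n, ℂ)} (hg : g ∈ numberSpan n) :
    inner ℂ (g.toLp 2 volume) f = 0 := by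
  induction hg using Submodule.span_induction with
  | mem g hg =>
    obtain ⟨γ, rfl⟩ := hg
    exact hf γ
  | zero =>
    rw [← SchwartzMap.toLpCLM_apply (𝕜 := ℂ), map_zero, inner_zero_left]
  | add g h _ _ hg hh =>
    rw [← SchwartzMap.toLpCLM_apply (𝕜 := ℂ)] at hg hh ⊢
    rw [map_add, inner_add_left, hg, hh, add_zero]
  | smul c g _ hg =>
    rw [← SchwartzMap.toLpCLM_apply (𝕜 := ℂ)] at hg ⊢
    rw [map_smul, inner_smul_left, hg, mul_zero]

theorem numberFun_zero (q : Conf n) :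
    numberFun 0 q = ((hermiteConst 0 ^ n * Real.exp (-‖q‖ ^ 2 / 2) : ℝ) : ℂ) := by
  simp only [numberFun, Pi.zero_apply, hermiteFun_zero]
  rw [Finset.prod_mul_distrib, ← Real.exp_sum, EuclideanSpace.norm_sq_eq, Finset.prod_const,
    Finset.card_univ, Fintype.card_fin, ← Finset.sum_div, ← Finset.sum_neg_distrib]
  simp

theorem integrable_exp_neg_sq_add_inner (c : ℝ) (ξ : Conf n) :
    Integrable fun q : Conf n => Real.exp (-‖q‖ ^ 2 + c * inner ℝ ξ q) := by
  have h := (GaussianFourier.integrable_cexp_neg_mul_sq_norm_add (b := 1) (by simp) (c : ℂ) ξ).re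
  refine h.congr (.of_forall fun q => ?_)
  have e : (-1 * (‖q‖ : ℂ) ^ 2 + c * (inner ℝ ξ q : ℝ) : ℂ) =
      ((-‖q‖ ^ 2 + c * inner ℝ ξ q : ℝ) : ℂ) := by push_cast; ring
  have e' := congrArg Complex.re (Complex.ofReal_exp (-‖q‖ ^ 2 + c * inner ℝ ξ q))
  rw [Complex.ofReal_re, ← e] at e'
  exact e'.symm

/-- The Gaussian absorbs any exponential: the square is at most a constant times
e^{-‖q‖²}(e^{2c⟨ξ,q⟩} + e^{-2c⟨ξ,q⟩}). This supplies the dominating function for the exponential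
series. -/
theorem memLp_exp_abs_inner_mul_numberFun (c : ℝ) (ξ : Conf n) :
    MemLp (fun q : Conf n => (Real.exp |c * inner ℝ ξ q| : ℂ) * numberFun 0 q) 2 := by
  have hc : Continuous fun q : Conf n => (Real.exp |c * inner ℝ ξ q| : ℂ) * numberFun 0 q := by
    have := (contDiff_numberFun (n := n) 0 (k := 0)).continuous
    fun_prop
  rw [memLp_two_iff_integrable_sq_norm hc.aestronglyMeasurable]
  have h := ((integrable_exp_neg_sq_add_inner (2 * c) ξ).add
    (integrable_exp_neg_sq_add_inner (-(2 * c)) ξ)).const_mul ((hermiteConst 0 ^ n) ^ 2)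
  refine h.mono' (hc.norm.pow 2).aestronglyMeasurable (.of_forall fun q => ?_)
  rw [norm_mul, mul_pow, numberFun_zero, Complex.norm_real, Complex.norm_real, Real.norm_eq_abs,
    Real.norm_eq_abs, Real.norm_eq_abs, sq_abs, sq_abs,
    abs_of_nonneg (by positivity), mul_pow, Pi.add_apply, mul_left_comm]
  refine mul_le_mul_of_nonneg_left ?_ (by positivity)
  rw [← Real.exp_nat_mul, ← Real.exp_nat_mul, ← Real.exp_add]
  rcases abs_cases (c * inner ℝ ξ q) with h | h <;> rw [h.1]
  · refine le_add_of_le_of_nonneg (Real.exp_le_exp.2 (le_of_eq ?_)) (Real.exp_pos _).le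
    push_cast; ring
  · refine le_add_of_nonneg_of_le (Real.exp_pos _).le (Real.exp_le_exp.2 (le_of_eq ?_))
    push_cast; ring

/-- Since ⟨ξ,q⟩^k|0⟩ stays in the span of the number basis, every moment ∫⟨ξ,q⟩^k|0⟩f vanishes.
Expanding e^{-2πi⟨ξ,q⟩} in powers and integrating termwise gives the claim. -/
theorem fourier_numberFun_mul_eq_zero {f : HSpace n} (hf : ∀ γ, inner ℂ (numberState γ) f = 0)
    (ξ : Conf n) : FourierTransform.fourier (fun q => numberFun 0 q * f q) ξ = 0 := by
  have hk : ∀ k : ℕ, ∫ q, ((inner ℝ ξ q : ℝ) : ℂ) ^ k * (numberFun 0 q * f q) = 0 := by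
    intro k
    have h := inner_toLp_eq_zero_of_mem_numberSpan hf
      (linearOp_pow_mem_numberSpan ξ k (Submodule.subset_span ⟨0, rfl⟩))
    rw [L2.inner_def] at h
    rw [← h]
    refine integral_congr_ae ?_
    filter_upwards [((linearOp ξ ^ k) (numberSchwartz 0)).coeFn_toLp 2 volume] with q hq
    rw [hq, linearOp_pow_apply, numberSchwartz_apply, numberFun_zero, RCLike.inner_apply, map_mul,
      map_pow, Complex.conj_ofReal, Complex.conj_ofReal]
    ring
  set t : Conf n → ℂ := fun q => ((-2 * Real.pi * inner ℝ ξ q : ℝ) : ℂ) * Complex.I with ht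
  -- The sum of the absolute values of all terms of the series, integrable as a product of two L²
  -- functions.
  have hint : Integrable fun q : Conf n =>
      ((Real.exp |2 * Real.pi * inner ℝ ξ q| : ℂ) * numberFun 0 q) * f q :=
    (memLp_exp_abs_inner_mul_numberFun (2 * Real.pi) ξ).integrable_mul (Lp.memLp f)
  have hn : ∀ q, ‖t q‖ = |2 * Real.pi * inner ℝ ξ q| := fun q => by
    simp [ht, abs_mul]
  have hmeas : AEStronglyMeasurable (fun q : Conf n => numberFun 0 q * f q) volume :=
    (contDiff_numberFun (n := n) 0 (k := 0)).continuous.aestronglyMeasurable.mul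
      (Lp.aestronglyMeasurable f)
  have hexp : ∀ q, HasSum (fun k : ℕ => (‖t q‖ ^ k / k.factorial) * ‖numberFun 0 q * f q‖)
      (Real.exp ‖t q‖ * ‖numberFun 0 q * f q‖) := fun q => by
    rw [Real.exp_eq_exp_ℝ]
    exact (NormedSpace.expSeries_div_hasSum_exp (𝔸 := ℝ) ‖t q‖).mul_right _
  have hs := hasSum_integral_of_dominated_convergence (μ := volume)
    (F := fun (k : ℕ) q => (t q ^ k / k.factorial) * (numberFun 0 q * f q))
    (f := fun q => Complex.exp (t q) * (numberFun 0 q * f q))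
    (fun k q => (‖t q‖ ^ k / k.factorial) * ‖numberFun 0 q * f q‖)
    (fun k => by
      refine AEStronglyMeasurable.mul (Continuous.aestronglyMeasurable ?_) hmeas
      simp only [ht]
      fun_prop)
    (fun k => .of_forall fun q => by simp)
    (.of_forall fun q => (hexp q).summable)
    (by
      refine hint.norm.congr (.of_forall fun q => ?_)
      simp only [(hexp q).tsum_eq]
      rw [hn, mul_assoc, norm_mul, Complex.norm_real, Real.norm_eq_abs, Real.abs_exp])
    (.of_forall fun q => by
      rw [Complex.exp_eq_exp_ℂ]
      exact (NormedSpace.expSeries_div_hasSum_exp (𝔸 := ℂ) (t q)).mul_right _)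
  have hz : ∀ k : ℕ, ∫ q, (t q ^ k / k.factorial) * (numberFun 0 q * f q) = 0 := by
    intro k
    have e : ∀ q, (t q ^ k / k.factorial) * (numberFun 0 q * f q) =
        ((-2 * Real.pi * Complex.I) ^ k / k.factorial) *
          (((inner ℝ ξ q : ℝ) : ℂ) ^ k * (numberFun 0 q * f q)) := by
      intro q
      simp only [ht]
      push_cast
      rw [mul_right_comm, mul_pow]
      ring
    simp only [e]
    rw [integral_const_mul, hk, mul_zero]
  simp only [hz] at hs
  have h0 := hs.unique hasSum_zero
  rw [Real.fourier_eq', ← h0]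
  congr 1
  ext q
  rw [smul_eq_mul, real_inner_comm]

/-- The integrable function |0⟩f has zero Fourier transform, so it vanishes almost everywhere; the
Gaussian |0⟩ has no zeros and can be divided out. -/
theorem eq_zero_of_inner_numberState_eq_zero {f : HSpace n}
    (hf : ∀ γ, inner ℂ (numberState γ) f = 0) : f = 0 := by
  have hint : Integrable fun q : Conf n => numberFun 0 q * f q :=
    (memLp_numberFun 0).integrable_mul (Lp.memLp f)
  have hS : ∀ φ : 𝓢(Conf n, ℂ), ∫ q, numberFun 0 q * f q * φ q = 0 := by
    intro φ
    -- Each test function φ is the Fourier transform of a Schwartz function, so the transform can be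
    -- moved onto |0⟩f.
    have h := VectorFourier.integral_fourierIntegral_smul_eq_flip (μ := volume) (ν := volume)
      (L := innerₗ (Conf n)) (g := (FourierTransform.fourierInv φ : 𝓢(Conf n, ℂ)))
      Real.continuous_fourierChar continuous_inner hint
      (SchwartzMap.integrable _)
    have e1 : ∀ ξ, VectorFourier.fourierIntegral Real.fourierChar volume (innerₗ (Conf n))
        (fun q : Conf n => numberFun 0 q * f q) ξ = 0 := fourier_numberFun_mul_eq_zero hf
    have e2 : ∀ q, VectorFourier.fourierIntegral Real.fourierChar volume (innerₗ (Conf n)).flip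
        (FourierTransform.fourierInv φ : 𝓢(Conf n, ℂ)) q = φ q := by
      intro q
      rw [flip_innerₗ]
      have := FourierInvPair.fourier_fourierInv_eq (F := 𝓢(Conf n, ℂ)) φ
      exact congrArg (fun ψ : 𝓢(Conf n, ℂ) => ψ q) this
    simp only [e1, e2, zero_mul, integral_zero, smul_eq_mul] at h
    exact h.symm
  have hae : ∀ᵐ q : Conf n, numberFun 0 q * f q = 0 := by
    refine ae_eq_zero_of_integral_contDiff_smul_eq_zero hint.locallyIntegrable fun g hg hc => ?_
    have hc' : HasCompactSupport (Complex.ofRealCLM ∘ g) := hc.comp_left rfl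
    have := hS (hc'.toSchwartzMap (by fun_prop))
    rw [← this]
    congr 1
    ext q
    simp [mul_comm]
  refine Lp.ext ?_
  filter_upwards [hae, Lp.coeFn_zero ℂ 2 (volume : Measure (Conf n))] with q hq h0
  rw [h0]
  refine (mul_eq_zero.1 hq).resolve_left ?_
  rw [numberFun_zero]
  have := hermiteConst_pos 0
  norm_cast
  positivity

/-- The number basis of `L²(ℝ^n)`. -/
def numberBasis (n : ℕ) : HilbertBasis (MultiIndex n) ℂ (HSpace n) :=
  HilbertBasis.mkOfOrthogonalEqBot orthonormal_numberState <| by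
    rw [Submodule.eq_bot_iff]
    intro f hf
    refine eq_zero_of_inner_numberState_eq_zero fun γ => ?_
    exact (Submodule.mem_orthogonal _ _).1 hf _ (Submodule.subset_span ⟨γ, rfl⟩)

theorem numberBasis_apply (γ : MultiIndex n) : numberBasis n γ = numberState γ := by
  simp [numberBasis]

end

end SchwartzOperators

namespace SchwartzOperators

open scoped ContDiff

noncomputable section

variable {n : ℕ}

/-! ### Estimates for Schwartz multisequences -/

/-- Any finite set of multi-indices lies in a box, over which the sum factors into one-dimensional
sums of (k + 1)⁻². -/
theorem summable_inv_basicWeight_sq (n : ℕ) :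
    Summable fun γ : MultiIndex n => (basicWeight γ ^ 2)⁻¹ := by
  have h1 : Summable fun k : ℕ => (((k : ℝ) + 1) ^ 2)⁻¹ := by
    have := (summable_nat_add_iff 1).2 (Real.summable_nat_pow_inv.2 (show 1 < 2 by norm_num))
    simpa using this
  refine summable_of_sum_le (c := (∑' k : ℕ, (((k : ℝ) + 1) ^ 2)⁻¹) ^ n)
    (fun γ => by positivity) fun u => ?_
  classical
  let t : Fin n → Finset ℕ := fun i => u.image fun γ => γ i
  calc ∑ γ ∈ u, (basicWeight γ ^ 2)⁻¹ ≤ ∑ γ ∈ Fintype.piFinset t, (basicWeight γ ^ 2)⁻¹ := by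
        refine Finset.sum_le_sum_of_subset_of_nonneg (fun γ hγ => ?_) fun γ _ _ => by positivity
        exact Fintype.mem_piFinset.2 fun i => Finset.mem_image_of_mem _ hγ
    _ = ∏ i, ∑ k ∈ t i, (((k : ℝ) + 1) ^ 2)⁻¹ := by
        rw [Finset.prod_univ_sum]
        refine Finset.sum_congr rfl fun γ _ => ?_
        rw [basicWeight, ← Finset.prod_pow, Finset.prod_inv_distrib]
    _ ≤ ∏ i : Fin n, ∑' k : ℕ, (((k : ℝ) + 1) ^ 2)⁻¹ :=
        Finset.prod_le_prod (fun i _ => Finset.sum_nonneg fun k _ => by positivity)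
          fun i _ => h1.sum_le_tsum _ fun k _ => by positivity
    _ = _ := by simp

/-- The sum `∑ ∏ (γ_i + 1)⁻²`. -/
def weightSum (n : ℕ) : ℝ := ∑' γ : MultiIndex n, (basicWeight γ ^ 2)⁻¹

theorem weightSum_nonneg (n : ℕ) : 0 ≤ weightSum n := tsum_nonneg fun γ => by positivity

theorem weight_le_basicWeight_pow (α γ : MultiIndex n) :
    weight α γ ≤ basicWeight γ ^ ∑ i, α i := by
  rw [weight, basicWeight, ← Finset.prod_pow]
  refine Finset.prod_le_prod (fun i _ => by positivity) fun i _ => ?_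
  exact pow_le_pow_right₀ (by simp) (Finset.single_le_sum (fun _ _ => Nat.zero_le _)
    (Finset.mem_univ i))

/-- Passage from sup bounds to ℓ² bounds: the power ∑ α_i dominates the weight, and the extra power,
once squared, makes the series converge. -/
theorem weight_mul_norm_sq_le {a : MultiIndex n → ℂ} {α : MultiIndex n} {M : ℝ}
    (h : ∀ γ, basicWeight γ ^ (∑ i, α i + 1) * ‖a γ‖ ≤ M) (γ : MultiIndex n) :
    (∏ i, ((γ i : ℝ) + 1) ^ (2 * α i)) * ‖a γ‖ ^ 2 ≤ M ^ 2 * (basicWeight γ ^ 2)⁻¹ := by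
  have hW := basicWeight_pos γ
  rw [← div_eq_mul_inv, le_div_iff₀ (by positivity), ← norm_weight_mul_sq, ← mul_pow, norm_mul,
    Complex.norm_real, Real.norm_of_nonneg (weight_pos α γ).le]
  have := weight_pos α γ
  refine pow_le_pow_left₀ (by positivity) (le_trans ?_ (h γ)) 2
  rw [pow_succ, mul_right_comm]
  gcongr
  exact weight_le_basicWeight_pow α γ

theorem isSchwartzSeq_of_bound {a : MultiIndex n → ℂ}
    (h : ∀ k, ∃ M, ∀ γ, basicWeight γ ^ k * ‖a γ‖ ≤ M) : IsSchwartzSeq a := by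
  rw [isSchwartzSeq_iff]
  intro α
  obtain ⟨M, hM⟩ := h (∑ i, α i + 1)
  exact Summable.of_nonneg_of_le (fun γ => by positivity) (weight_mul_norm_sq_le hM)
    ((summable_inv_basicWeight_sq n).mul_left _)

namespace SchwartzSeq

theorem seminormFamily_le_of_bound (a : SchwartzSeq n) (α : MultiIndex n) {M : ℝ} (hM : 0 ≤ M)
    (h : ∀ γ, basicWeight γ ^ (∑ i, α i + 1) * ‖a.toFun γ‖ ≤ M) :
    seminormFamily n α a ≤ √(weightSum n) * M := by
  have hs := (summable_inv_basicWeight_sq n).mul_left (M ^ 2)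
  rw [seminormFamily_apply]
  refine Real.sqrt_le_iff.2 ⟨by positivity, ?_⟩
  rw [mul_pow, Real.sq_sqrt (weightSum_nonneg n), weightSum, mul_comm, ← tsum_mul_left]
  exact (Summable.of_nonneg_of_le (fun γ => by positivity) (weight_mul_norm_sq_le h) hs).tsum_le_tsum
    (weight_mul_norm_sq_le h) hs

theorem basicWeight_pow_mul_norm_le (a : SchwartzSeq n) (k : ℕ) (γ : MultiIndex n) :
    basicWeight γ ^ k * ‖a.toFun γ‖ ≤ seminormFamily n (fun _ => k) a := by
  have h := lp.norm_apply_le_norm (by norm_num) (weightMap (fun _ => k) a) γ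
  refine le_trans (le_of_eq ?_) h
  have e : weightMap (fun _ => k) a γ = (weight (fun _ => k) γ : ℂ) * a.toFun γ := rfl
  rw [e, norm_mul, Complex.norm_real, weight_const,
    Real.norm_of_nonneg (pow_nonneg (basicWeight_pos γ).le _)]

/-- The ℓ² seminorms bound each single term; two spare powers of the weight then turn this into an
ℓ¹ bound. -/
theorem basicWeight_pow_mul_norm_le_mul (a : SchwartzSeq n) (k : ℕ) (γ : MultiIndex n) :
    basicWeight γ ^ k * ‖a.toFun γ‖ ≤
      seminormFamily n (fun _ => k + 2) a * (basicWeight γ ^ 2)⁻¹ := by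
  have hW := basicWeight_pos γ
  rw [← div_eq_mul_inv, le_div_iff₀ (by positivity), mul_right_comm, ← pow_add]
  exact basicWeight_pow_mul_norm_le a (k + 2) γ

theorem summable_basicWeight_pow_mul_norm (a : SchwartzSeq n) (k : ℕ) :
    Summable fun γ => basicWeight γ ^ k * ‖a.toFun γ‖ :=
  Summable.of_nonneg_of_le
    (fun γ => mul_nonneg (pow_nonneg (basicWeight_pos γ).le _) (norm_nonneg _))
    (basicWeight_pow_mul_norm_le_mul a k) ((summable_inv_basicWeight_sq n).mul_left _)

theorem tsum_basicWeight_pow_mul_norm_le (a : SchwartzSeq n) (k : ℕ) :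
    ∑' γ, basicWeight γ ^ k * ‖a.toFun γ‖ ≤
      weightSum n * seminormFamily n (fun _ => k + 2) a := by
  rw [mul_comm, weightSum, ← tsum_mul_left]
  exact (summable_basicWeight_pow_mul_norm a k).tsum_le_tsum
    (basicWeight_pow_mul_norm_le_mul a k) ((summable_inv_basicWeight_sq n).mul_left _)

theorem summable_norm (a : SchwartzSeq n) : Summable fun γ => ‖a.toFun γ‖ := by
  simpa using summable_basicWeight_pow_mul_norm a 0

/-- If `‖x_γ‖ ≤ C (basicWeight γ)^m` then `∑ ‖a_γ‖ ‖x_γ‖` is controlled by a seminorm of `a`. -/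
theorem summable_norm_mul_of_le (a : SchwartzSeq n) {x : MultiIndex n → ℝ} {C : ℝ} {m : ℕ}
    (hx0 : ∀ γ, 0 ≤ x γ) (hx : ∀ γ, x γ ≤ C * basicWeight γ ^ m) :
    Summable (fun γ => ‖a.toFun γ‖ * x γ) ∧
      ∑' γ, ‖a.toFun γ‖ * x γ ≤ C * weightSum n * seminormFamily n (fun _ => m + 2) a := by
  have hle : ∀ γ, ‖a.toFun γ‖ * x γ ≤ C * (basicWeight γ ^ m * ‖a.toFun γ‖) := fun γ => by
    refine (mul_le_mul_of_nonneg_left (hx γ) (norm_nonneg _)).trans_eq (by ring)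
  have hs := (summable_basicWeight_pow_mul_norm a m).mul_left C
  have hs' := Summable.of_nonneg_of_le (fun γ => mul_nonneg (norm_nonneg _) (hx0 γ)) hle hs
  refine ⟨hs', (hs'.tsum_le_tsum hle hs).trans ?_⟩
  -- The bound at the index 0, where the weight is positive, forces C to be nonnegative.
  have hC : 0 ≤ C := by
    have := (hx0 0).trans (hx 0)
    exact nonneg_of_mul_nonneg_left this (pow_pos (basicWeight_pos _) _)
  rw [tsum_mul_left, mul_assoc]
  exact mul_le_mul_of_nonneg_left (tsum_basicWeight_pow_mul_norm_le a m) hC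

end SchwartzSeq

/-! ### Hermite coefficients of Schwartz functions -/

/-- The coefficients of a Schwartz function in the number basis. -/
def hermiteCoeff (f : 𝓢(Conf n, ℂ)) (γ : MultiIndex n) : ℂ :=
  inner ℂ (numberState γ) (f.toLp 2 volume)

theorem basicWeight_le_norm (γ : MultiIndex n) (k : ℕ) :
    basicWeight γ ^ k ≤ ‖∏ i, (2 * (γ i : ℂ) + 1) ^ k‖ := by
  rw [basicWeight, ← Finset.prod_pow, norm_prod]
  refine Finset.prod_le_prod (fun i _ => by positivity) fun i _ => ?_
  rw [norm_pow]
  refine pow_le_pow_left₀ (by positivity) ?_ k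
  have e : (2 * (γ i : ℂ) + 1) = ((2 * γ i + 1 : ℝ) : ℂ) := by push_cast; ring
  rw [e, Complex.norm_real, Real.norm_of_nonneg (by positivity)]
  linarith [(Nat.cast_nonneg (γ i) : (0 : ℝ) ≤ γ i)]

/-- B is a formal adjoint of ∏(P_i² + Q_i²)^k, whose eigenvalue on |γ⟩ is at least the k-th power of
the weight. As B depends on neither f nor γ, the bound is a continuous seminorm of f. -/
theorem exists_basicWeight_pow_mul_norm_hermiteCoeff_le (n k : ℕ) :
    ∃ B : 𝓢(Conf n, ℂ) →L[ℂ] 𝓢(Conf n, ℂ), ∀ f γ,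
      basicWeight γ ^ k * ‖hermiteCoeff f γ‖ ≤ ‖(B f).toLp 2 volume‖ := by
  obtain ⟨B, hB⟩ := exists_isFormalAdjoint_opPow (isFormalAdjoint_numberOp (n := n)) fun _ => k
  refine ⟨B, fun f γ => ?_⟩
  have h := hB (numberSchwartz γ) f
  rw [opPow_numberOp_numberSchwartz, ← SchwartzMap.toLpCLM_apply (𝕜 := ℂ), map_smul,
    inner_smul_left, SchwartzMap.toLpCLM_apply, toLp_numberSchwartz] at h
  calc basicWeight γ ^ k * ‖hermiteCoeff f γ‖
      ≤ ‖∏ i, (2 * (γ i : ℂ) + 1) ^ k‖ * ‖hermiteCoeff f γ‖ :=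
        mul_le_mul_of_nonneg_right (basicWeight_le_norm γ k) (norm_nonneg _)
    _ = ‖inner ℂ (numberState γ) ((B f).toLp 2 volume)‖ := by
        rw [← h, norm_mul, RCLike.norm_conj, hermiteCoeff]
    _ ≤ ‖numberState γ‖ * ‖(B f).toLp 2 volume‖ := norm_inner_le_norm _ _
    _ = _ := by rw [orthonormal_numberState.norm_eq_one, one_mul]

theorem isSchwartzSeq_hermiteCoeff (f : 𝓢(Conf n, ℂ)) : IsSchwartzSeq (hermiteCoeff f) :=
  isSchwartzSeq_of_bound fun k =>
    let ⟨_, hB⟩ := exists_basicWeight_pow_mul_norm_hermiteCoeff_le n k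
    ⟨_, hB f⟩

/-- The map from a Schwartz function to its Hermite coefficients. -/
def hermiteCoeffMap (n : ℕ) : 𝓢(Conf n, ℂ) →ₗ[ℂ] SchwartzSeq n where
  toFun f := ⟨hermiteCoeff f, isSchwartzSeq_hermiteCoeff f⟩
  map_add' f g := by
    refine Subtype.ext (funext fun γ => ?_)
    exact (congrArg (inner ℂ (numberState γ))
      ((SchwartzMap.toLpCLM ℂ ℂ 2 (volume : Measure (Conf n))).map_add f g)).trans
      (inner_add_right _ _ _)
  map_smul' c f := by
    refine Subtype.ext (funext fun γ => ?_)
    exact (congrArg (inner ℂ (numberState γ))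
      ((SchwartzMap.toLpCLM ℂ ℂ 2 (volume : Measure (Conf n))).map_smul c f)).trans
      (inner_smul_right _ _ _)

theorem continuous_hermiteCoeffMap (n : ℕ) : Continuous (hermiteCoeffMap n) := by
  refine SchwartzSeq.withSeminorms.continuous_of_continuous_comp _ fun α => ?_
  obtain ⟨B, hB⟩ := exists_basicWeight_pow_mul_norm_hermiteCoeff_le n (∑ i, α i + 1)
  let L : 𝓢(Conf n, ℂ) →L[ℂ] HSpace n := (SchwartzMap.toLpCLM ℂ ℂ 2 volume).comp B
  let p : Seminorm ℂ 𝓢(Conf n, ℂ) :=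
    (Real.toNNReal √(weightSum n)) • (normSeminorm ℂ (HSpace n)).comp (L : _ →ₗ[ℂ] _)
  have hp : Continuous p :=
    (continuous_norm.comp L.continuous).const_smul (Real.toNNReal √(weightSum n))
  refine Seminorm.continuous_of_le hp fun f => ?_
  have := SchwartzSeq.seminormFamily_le_of_bound (hermiteCoeffMap n f) α (norm_nonneg _) (hB f)
  refine this.trans_eq ?_
  rw [_root_.smul_apply, NNReal.smul_def, Real.coe_toNNReal _ (Real.sqrt_nonneg _)]
  rfl

/-! ### Hermite expansions -/

theorem norm_iteratedFDeriv_smul_numberFun_le {C : ℝ} {m k l : ℕ}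
    (h : ∀ (γ : MultiIndex n) (q : Conf n),
      ‖q‖ ^ k * ‖iteratedFDeriv ℝ l (numberFun γ) q‖ ≤ C * basicWeight γ ^ m)
    (a : SchwartzSeq n) (γ : MultiIndex n) (q : Conf n) :
    ‖q‖ ^ k * ‖iteratedFDeriv ℝ l (fun q => a.toFun γ * numberFun γ q) q‖ ≤
      ‖a.toFun γ‖ * (C * basicWeight γ ^ m) := by
  have e : iteratedFDeriv ℝ l (fun q => a.toFun γ * numberFun γ q) q =
      a.toFun γ • iteratedFDeriv ℝ l (numberFun γ) q := by
    have : (fun q => a.toFun γ * numberFun γ q) = a.toFun γ • numberFun γ := rfl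
    rw [this, iteratedFDeriv_const_smul_apply (contDiff_numberFun γ).contDiffAt]
  rw [e, norm_smul, mul_left_comm]
  exact mul_le_mul_of_nonneg_left (h γ q) (norm_nonneg _)

/-- The function `∑ a_γ |γ⟩`. -/
def hermiteSum (a : SchwartzSeq n) (q : Conf n) : ℂ := ∑' γ, a.toFun γ * numberFun γ q

/-- A polynomial bound for the seminorms of the number basis. -/
theorem exists_bound_numberFun (n k l : ℕ) : ∃ (C : ℝ) (m : ℕ), 0 ≤ C ∧
    ∀ (γ : MultiIndex n) (q : Conf n),
      ‖q‖ ^ k * ‖iteratedFDeriv ℝ l (numberFun γ) q‖ ≤ C * basicWeight γ ^ m :=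
  isPolyBounded_norm_pow_mul_iteratedFDeriv_numberFun k l

theorem summable_norm_mul_weight (a : SchwartzSeq n) {C : ℝ} (hC : 0 ≤ C) (m : ℕ) :
    Summable (fun γ => ‖a.toFun γ‖ * (C * basicWeight γ ^ m)) ∧
      ∑' γ, ‖a.toFun γ‖ * (C * basicWeight γ ^ m) ≤
        C * weightSum n * SchwartzSeq.seminormFamily n (fun _ => m + 2) a :=
  a.summable_norm_mul_of_le
    (fun γ => mul_nonneg hC (pow_nonneg (basicWeight_pos γ).le _)) fun _ => le_rfl

theorem contDiff_smul_numberFun (a : SchwartzSeq n) (γ : MultiIndex n) {k : WithTop ℕ∞} :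
    ContDiff ℝ k fun q => a.toFun γ * numberFun γ q :=
  contDiff_const.mul (contDiff_numberFun γ)

theorem exists_summable_bound (a : SchwartzSeq n) : ∃ v : ℕ → MultiIndex n → ℝ,
    (∀ l, Summable (v l)) ∧ ∀ l γ q,
      ‖iteratedFDeriv ℝ l (fun q => a.toFun γ * numberFun γ q) q‖ ≤ v l γ := by
  choose C m hC h using fun l => exists_bound_numberFun n 0 l
  refine ⟨fun l γ => ‖a.toFun γ‖ * (C l * basicWeight γ ^ m l),
    fun l => (summable_norm_mul_weight a (hC l) (m l)).1, fun l γ q => ?_⟩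
  simpa using norm_iteratedFDeriv_smul_numberFun_le (h l) a γ q

theorem contDiff_hermiteSum (a : SchwartzSeq n) : ContDiff ℝ ∞ (hermiteSum a) := by
  obtain ⟨v, hv, hle⟩ := exists_summable_bound a
  exact contDiff_tsum (N := ⊤) (fun γ => contDiff_smul_numberFun a γ) (fun l _ => hv l)
    fun l γ q _ => hle l γ q

theorem iteratedFDeriv_hermiteSum (a : SchwartzSeq n) (l : ℕ) (q : Conf n) :
    iteratedFDeriv ℝ l (hermiteSum a) q =
      ∑' γ, iteratedFDeriv ℝ l (fun q => a.toFun γ * numberFun γ q) q := by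
  obtain ⟨v, hv, hle⟩ := exists_summable_bound a
  exact iteratedFDeriv_tsum_apply (N := ⊤) (fun γ => contDiff_smul_numberFun a γ) (fun l _ => hv l)
    (fun l γ q _ => hle l γ q) le_top q

/-- Differentiate termwise: polynomial growth of the seminorms of |γ⟩ is beaten by the decay of a,
at the cost of two further powers of the weight for summability. -/
theorem exists_bound_iteratedFDeriv_hermiteSum (n k l : ℕ) : ∃ (C : ℝ) (m : ℕ), 0 ≤ C ∧
    ∀ (a : SchwartzSeq n) (q : Conf n), ‖q‖ ^ k * ‖iteratedFDeriv ℝ l (hermiteSum a) q‖ ≤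
        C * SchwartzSeq.seminormFamily n (fun _ => m) a := by
  obtain ⟨C, m, hC, h⟩ := exists_bound_numberFun n k l
  refine ⟨C * weightSum n, m + 2, mul_nonneg hC (weightSum_nonneg n), fun a q => ?_⟩
  obtain ⟨v, hv, hle⟩ := exists_summable_bound a
  have hs : Summable fun γ =>
      ‖iteratedFDeriv ℝ l (fun q => a.toFun γ * numberFun γ q) q‖ :=
    Summable.of_nonneg_of_le (fun γ => norm_nonneg _) (fun γ => hle l γ q) (hv l)
  obtain ⟨hs2, hle2⟩ := summable_norm_mul_weight a hC m
  rw [iteratedFDeriv_hermiteSum]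
  calc _ ≤ ‖q‖ ^ k * ∑' γ, ‖iteratedFDeriv ℝ l (fun q => a.toFun γ * numberFun γ q) q‖ :=
        mul_le_mul_of_nonneg_left (norm_tsum_le_tsum_norm hs) (by positivity)
    _ = ∑' γ, ‖q‖ ^ k * ‖iteratedFDeriv ℝ l (fun q => a.toFun γ * numberFun γ q) q‖ :=
        tsum_mul_left.symm
    _ ≤ ∑' γ, ‖a.toFun γ‖ * (C * basicWeight γ ^ m) :=
        (hs.mul_left _).tsum_le_tsum
          (fun γ => norm_iteratedFDeriv_smul_numberFun_le h a γ q) hs2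
    _ ≤ _ := hle2

/-- The Schwartz function `∑ a_γ |γ⟩`. -/
def hermiteExpansion (a : SchwartzSeq n) : 𝓢(Conf n, ℂ) where
  toFun := hermiteSum a
  smooth' := contDiff_hermiteSum a
  decay' k l := by
    obtain ⟨C, m, -, h⟩ := exists_bound_iteratedFDeriv_hermiteSum n k l
    exact ⟨_, h a⟩

theorem exists_seminorm_hermiteExpansion_le (n k l : ℕ) : ∃ (C : ℝ) (m : ℕ), 0 ≤ C ∧
    ∀ a : SchwartzSeq n, SchwartzMap.seminorm ℂ k l (hermiteExpansion a) ≤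
      C * SchwartzSeq.seminormFamily n (fun _ => m) a := by
  obtain ⟨C, m, hC, h⟩ := exists_bound_iteratedFDeriv_hermiteSum n k l
  exact ⟨C, m, hC, fun a => SchwartzMap.seminorm_le_bound _ _ _ _
    (mul_nonneg hC (apply_nonneg _ _)) (h a)⟩

/-- Orthonormality, once sum and integral are exchanged. The exchange holds because |δ⟩ is in L¹ and
the sup norms of |γ⟩ grow polynomially while a decays rapidly. -/
theorem hermiteCoeff_hermiteExpansion (a : SchwartzSeq n) :
    hermiteCoeff (hermiteExpansion a) = a.toFun := by
  funext δ
  have hI : ∀ γ, Integrable fun q => inner ℂ (numberSchwartz δ q) (a.toFun γ * numberFun γ q) := by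
    intro γ
    have h1 : MemLp (fun q => a.toFun γ * numberFun γ q) 2 (volume : Measure (Conf n)) :=
      (memLp_numberFun γ).const_mul _
    have h2 : MemLp (fun q => starRingEnd ℂ (numberFun δ q)) 2 (volume : Measure (Conf n)) :=
      (memLp_numberFun δ).star
    simpa [RCLike.inner_apply, numberSchwartz_apply] using! h1.integrable_mul h2
  have hsum : Summable fun γ =>
      ∫ q, ‖inner ℂ (numberSchwartz δ q) (a.toFun γ * numberFun γ q)‖ := by
    have hd : Integrable fun q : Conf n => ‖numberSchwartz δ q‖ :=
      (SchwartzMap.integrable _).norm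
    have h0 : ∀ γ (q : Conf n), ‖numberFun γ q‖ ≤ 2 ^ n * basicWeight γ ^ 1 := fun γ q => by
      simpa using norm_numberFun_le γ q
    have hs := (summable_norm_mul_weight a (C := 2 ^ n) (by positivity) 1).1.mul_right
      (∫ q : Conf n, ‖numberSchwartz δ q‖)
    refine Summable.of_nonneg_of_le (fun γ => integral_nonneg fun q => norm_nonneg _)
      (fun γ => ?_) hs
    rw [← integral_const_mul]
    refine integral_mono (hI γ).norm (hd.const_mul _) fun q => ?_
    simp only
    rw [RCLike.inner_apply, norm_mul, norm_mul, RCLike.norm_conj]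
    exact mul_le_mul_of_nonneg_right (mul_le_mul_of_nonneg_left (h0 γ q) (norm_nonneg _))
      (norm_nonneg _)
  have key := hasSum_integral_of_summable_integral_norm hI hsum
  have hpt : ∀ q, Summable fun γ => a.toFun γ * numberFun γ q := fun q => by
    obtain ⟨v, hv, hle⟩ := exists_summable_bound a
    refine Summable.of_norm_bounded (hv 0) fun γ => ?_
    simpa using hle 0 γ q
  have e1 : ∀ q, ∑' γ, inner ℂ (numberSchwartz δ q) (a.toFun γ * numberFun γ q) =
      inner ℂ (numberSchwartz δ q) (hermiteExpansion a q) := fun q =>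
    (((hpt q).hasSum.mapL (innerSL ℂ (numberSchwartz δ q))).tsum_eq)
  have e2 : ∀ γ, ∫ q, inner ℂ (numberSchwartz δ q) (a.toFun γ * numberFun γ q) =
      if γ = δ then a.toFun δ else 0 := fun γ => by
    have h := orthonormal_iff_ite.1 (orthonormal_numberState (n := n)) δ γ
    rw [← toLp_numberSchwartz, ← toLp_numberSchwartz, inner_toLp_toLp] at h
    have e : ∀ q, inner ℂ (numberSchwartz δ q) (a.toFun γ * numberFun γ q) =
        a.toFun γ * inner ℂ (numberSchwartz δ q) (numberSchwartz γ q) := fun q =>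
      inner_smul_right _ _ _
    simp only [e]
    rw [integral_const_mul, h]
    by_cases hγ : γ = δ
    · simp [hγ]
    · simp [hγ, Ne.symm hγ]
  simp only [e1, e2] at key
  rw [hermiteCoeff, ← toLp_numberSchwartz, inner_toLp_toLp]
  exact key.unique (hasSum_ite_eq δ _)

theorem eq_of_inner_numberState_eq {f g : HSpace n}
    (h : ∀ γ, inner ℂ (numberState γ) f = inner ℂ (numberState γ) g) : f = g := by
  refine sub_eq_zero.1 (eq_zero_of_inner_numberState_eq_zero fun γ => ?_)
  rw [inner_sub_right, h, sub_self]

theorem hermiteCoeff_injective :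
    Function.Injective (hermiteCoeff : 𝓢(Conf n, ℂ) → MultiIndex n → ℂ) := fun _ _ h =>
  SchwartzMap.injective_toLp 2 volume (eq_of_inner_numberState_eq fun γ => congrFun h γ)

theorem SchwartzSeq.ext {a b : SchwartzSeq n} (h : a.toFun = b.toFun) : a = b := Subtype.ext h

/-- The Hermite expansion as a topological isomorphism between the Schwartz space and the space of
Schwartz multisequences. -/
def hermiteEquiv (n : ℕ) : 𝓢(Conf n, ℂ) ≃L[ℂ] SchwartzSeq n :=
  let e : 𝓢(Conf n, ℂ) ≃ₗ[ℂ] SchwartzSeq n :=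
    { hermiteCoeffMap n with
      invFun := hermiteExpansion
      -- A function and its expansion have the same coefficients, so completeness makes the right
      -- inverse two-sided.
      left_inv := fun f => hermiteCoeff_injective (hermiteCoeff_hermiteExpansion _)
      right_inv := fun a => SchwartzSeq.ext (hermiteCoeff_hermiteExpansion a) }
  { e with
    continuous_toFun := continuous_hermiteCoeffMap n
    continuous_invFun := by
      have := SchwartzSeq.withSeminorms (n := n).topologicalAddGroup
      refine (schwartz_withSeminorms ℂ (Conf n) ℂ).continuous_of_continuous_comp
        (e.symm : SchwartzSeq n →ₗ[ℂ] 𝓢(Conf n, ℂ)) fun i => ?_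
      obtain ⟨C, m, hC, h⟩ := exists_seminorm_hermiteExpansion_le n i.1 i.2
      have hp : Continuous (C.toNNReal • SchwartzSeq.seminormFamily n fun _ => m) :=
        (SchwartzSeq.withSeminorms.continuous_seminorm _).const_smul C.toNNReal
      refine Seminorm.continuous_of_le hp fun a => (h a).trans_eq ?_
      rw [_root_.smul_apply, NNReal.smul_def, Real.coe_toNNReal _ hC]
      rfl }

theorem hermiteCoeff_hermiteEquiv_symm (a : SchwartzSeq n) :
    hermiteCoeff ((hermiteEquiv n).symm a) = a.toFun := hermiteCoeff_hermiteExpansion a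

end

end SchwartzOperators

namespace SchwartzOperators

noncomputable section

variable {n N : ℕ}

/-! ### Canonical commutation relations and normal ordering -/

theorem commute_positionOp (i j : Fin n) : Commute (positionOp n i) (positionOp n j) := by
  ext f q
  simp only [mul_apply_eq_comp, positionOp_apply]
  ring

theorem momentumOp_apply_fderiv (i : Fin n) (f : 𝓢(Conf n, ℂ)) (q : Conf n) :
    momentumOp n i f q = -Complex.I * fderiv ℝ f q (EuclideanSpace.single i (1 : ℝ)) := by
  rw [momentumOp_apply, f.differentiableAt.lineDeriv_eq_fderiv]

theorem fderiv_momentumOp (i : Fin n) (f : 𝓢(Conf n, ℂ)) (q v : Conf n) :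
    fderiv ℝ (momentumOp n i f) q v =
      -Complex.I * fderiv ℝ (fderiv ℝ f) q v (EuclideanSpace.single i (1 : ℝ)) := by
  have hd : DifferentiableAt ℝ (fderiv ℝ f) q :=
    (((f.smooth 2).fderiv_right (m := 1) le_rfl).differentiable one_ne_zero) q
  have h := (hd.hasFDerivAt.clm_apply
    (hasFDerivAt_const (EuclideanSpace.single i (1 : ℝ)) q)).const_smul (-Complex.I)
  have e : (momentumOp n i f : Conf n → ℂ) =
      (-Complex.I) • fun q => fderiv ℝ f q (EuclideanSpace.single i (1 : ℝ)) :=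
    funext fun q => momentumOp_apply_fderiv i f q
  rw [e, HasFDerivAt.fderiv h]
  simp

theorem commute_momentumOp (i j : Fin n) : Commute (momentumOp n i) (momentumOp n j) := by
  ext f q
  simp only [mul_apply_eq_comp, momentumOp_apply_fderiv i, momentumOp_apply_fderiv j,
    fderiv_momentumOp]
  have hs : IsSymmSndFDerivAt ℝ f q := ((f.smooth 2).contDiffAt).isSymmSndFDerivAt (by simp)
  rw [hs.eq]

/-- The product rule applied to ∂_j(q_i f). -/
theorem positionOp_mul_momentumOp (i j : Fin n) : positionOp n i * momentumOp n j =
    momentumOp n j * positionOp n i + (if j = i then Complex.I else 0) • 1 := by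
  ext f q
  have hp : HasFDerivAt (fun q : Conf n => (q i : ℂ))
      (Complex.ofRealCLM.comp (EuclideanSpace.proj i : Conf n →L[ℝ] ℝ)) q :=
    (Complex.ofRealCLM.comp (EuclideanSpace.proj i : Conf n →L[ℝ] ℝ)).hasFDerivAt
  have h := hp.mul (f.hasFDerivAt q)
  have e : (positionOp n i f : Conf n → ℂ) = (fun q : Conf n => (q i : ℂ)) * (f : Conf n → ℂ) :=
    funext fun q => positionOp_apply n i f q
  simp only [_root_.add_apply, _root_.smul_apply, mul_apply_eq_comp, positionOp_apply,
    momentumOp_apply_fderiv j]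
  rw [e, HasFDerivAt.fderiv h]
  by_cases hij : j = i
  · simp [hij]
    ring
  · simp [hij, Ne.symm hij]
    ring

theorem prod_ofFn_pow_raise {M : Type*} [Monoid M] {n : ℕ} (A : Fin n → M)
    (hA : ∀ i j, Commute (A i) (A j)) (α : MultiIndex n) (i : Fin n) :
    (List.ofFn fun j => A j ^ raise α i j).prod = A i * (List.ofFn fun j => A j ^ α j).prod := by
  induction n with
  | zero => exact i.elim0
  | succ n ih =>
    simp only [List.ofFn_succ, List.prod_cons]
    refine Fin.cases ?_ (fun i => ?_) i
    · simp [raise, pow_succ', mul_assoc]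
    · have h := ih (fun j => A j.succ) (fun i j => hA _ _) (fun j => α j.succ) i
      have e : (fun j => A j.succ ^ raise α i.succ j.succ) =
          fun j => A j.succ ^ raise (fun j => α j.succ) i j := by
        funext j
        by_cases hj : j = i
        · simp [raise, hj]
        · simp [raise, hj]
      have e0 : raise α i.succ 0 = α 0 := Function.update_of_ne (Fin.succ_ne_zero i).symm _ _
      rw [e, h, e0, ← mul_assoc, ← mul_assoc, ((hA i.succ 0).pow_right (α 0)).eq]

theorem opPow_raise {A : Fin n → (𝓢(Conf n, ℂ) →L[ℂ] 𝓢(Conf n, ℂ))}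
    (hA : ∀ i j, Commute (A i) (A j)) (α : MultiIndex n) (i : Fin n) :
    opPow A (raise α i) = A i * opPow A α :=
  prod_ofFn_pow_raise A hA α i

theorem opPow_zero (A : Fin n → (𝓢(Conf n, ℂ) →L[ℂ] 𝓢(Conf n, ℂ))) : opPow A 0 = 1 := by
  simp [opPow]

/-- Induction on the total degree: a nonzero multi-index is the raising of one of smaller degree. -/
theorem multiIndex_induction {p : MultiIndex n → Prop} (h0 : p 0)
    (h : ∀ α i, p α → p (raise α i)) (α : MultiIndex n) : p α := by
  induction hk : ∑ i, α i generalizing α with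
  | zero =>
    have : α = 0 := funext fun i => (Finset.sum_eq_zero_iff.1 hk) i (Finset.mem_univ i)
    rwa [this]
  | succ k ih =>
    obtain ⟨i, -, hi⟩ : ∃ i ∈ Finset.univ, α i ≠ 0 :=
      Finset.exists_ne_zero_of_sum_ne_zero (by omega)
    rw [← raise_lower α i hi]
    refine h _ i (ih _ ?_)
    have h1 : ∑ j, raise (lower α i) i j = k + 1 := by rw [raise_lower α i hi, hk]
    have h2 : ∑ j, raise (lower α i) i j = ∑ j, lower α i j + 1 := by
      rw [raise, Finset.sum_update_of_mem (Finset.mem_univ i),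
        ← Finset.add_sum_erase _ _ (Finset.mem_univ i), Finset.sdiff_singleton_eq_erase]
      ring
    omega

/-- The span of the operators `P^β`. -/
def momentumSpan (n : ℕ) : Submodule ℂ (𝓢(Conf n, ℂ) →L[ℂ] 𝓢(Conf n, ℂ)) :=
  Submodule.span ℂ (Set.range (opPow (momentumOp n)))

/-- The span of the operators `P^β Q^α`. -/
def normalSpan (n : ℕ) : Submodule ℂ (𝓢(Conf n, ℂ) →L[ℂ] 𝓢(Conf n, ℂ)) :=
  Submodule.span ℂ (Set.range fun a : MultiIndex n × MultiIndex n =>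
    opPow (momentumOp n) a.1 * opPow (positionOp n) a.2)

theorem momentumOp_mul_mem_momentumSpan (i : Fin n) {A : 𝓢(Conf n, ℂ) →L[ℂ] 𝓢(Conf n, ℂ)}
    (hA : A ∈ momentumSpan n) : momentumOp n i * A ∈ momentumSpan n := by
  induction hA using Submodule.span_induction with
  | mem A hA =>
    obtain ⟨β, rfl⟩ := hA
    rw [← opPow_raise commute_momentumOp]
    exact Submodule.subset_span ⟨_, rfl⟩
  | zero => rw [mul_zero]; exact Submodule.zero_mem _
  | add A B _ _ hA hB => rw [mul_add]; exact Submodule.add_mem _ hA hB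
  | smul c A _ hA => rw [mul_smul_comm]; exact Submodule.smul_mem _ _ hA

/-- The commutator of Q_i with a momentum word contains no position operator. Recording only this
makes the induction close and keeps the correction normally ordered after multiplication by Q^α. -/
theorem positionOp_mul_opPow_momentumOp (i : Fin n) (β : MultiIndex n) :
    ∃ A ∈ momentumSpan n, positionOp n i * opPow (momentumOp n) β =
      opPow (momentumOp n) β * positionOp n i + A := by
  induction β using multiIndex_induction with
  | h0 => exact ⟨0, Submodule.zero_mem _, by rw [opPow_zero]; simp⟩
  | h β j ih =>
    obtain ⟨A, hA, h⟩ := ih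
    refine ⟨momentumOp n j * A + (if j = i then Complex.I else 0) • opPow (momentumOp n) β,
      Submodule.add_mem _ (momentumOp_mul_mem_momentumSpan j hA)
        (Submodule.smul_mem _ _ (Submodule.subset_span ⟨_, rfl⟩)), ?_⟩
    rw [opPow_raise commute_momentumOp, ← mul_assoc, positionOp_mul_momentumOp, add_mul, mul_assoc,
      h, smul_mul_assoc, one_mul, mul_add, mul_assoc, add_assoc]

theorem momentumSpan_mul_mem_normalSpan {A : 𝓢(Conf n, ℂ) →L[ℂ] 𝓢(Conf n, ℂ)}
    (hA : A ∈ momentumSpan n) (α : MultiIndex n) :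
    A * opPow (positionOp n) α ∈ normalSpan n := by
  induction hA using Submodule.span_induction with
  | mem A hA =>
    obtain ⟨β, rfl⟩ := hA
    exact Submodule.subset_span ⟨(β, α), rfl⟩
  | zero => rw [zero_mul]; exact Submodule.zero_mem _
  | add A B _ _ hA hB => rw [add_mul]; exact Submodule.add_mem _ hA hB
  | smul c A _ hA => rw [smul_mul_assoc]; exact Submodule.smul_mem _ _ hA

theorem momentumOp_mul_mem_normalSpan (i : Fin n) {A : 𝓢(Conf n, ℂ) →L[ℂ] 𝓢(Conf n, ℂ)}
    (hA : A ∈ normalSpan n) : momentumOp n i * A ∈ normalSpan n := by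
  induction hA using Submodule.span_induction with
  | mem A hA =>
    obtain ⟨⟨β, α⟩, rfl⟩ := hA
    simp only
    rw [← mul_assoc, ← opPow_raise commute_momentumOp]
    exact Submodule.subset_span ⟨(raise β i, α), rfl⟩
  | zero => rw [mul_zero]; exact Submodule.zero_mem _
  | add A B _ _ hA hB => rw [mul_add]; exact Submodule.add_mem _ hA hB
  | smul c A _ hA => rw [mul_smul_comm]; exact Submodule.smul_mem _ _ hA

theorem positionOp_mul_mem_normalSpan (i : Fin n) {A : 𝓢(Conf n, ℂ) →L[ℂ] 𝓢(Conf n, ℂ)}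
    (hA : A ∈ normalSpan n) : positionOp n i * A ∈ normalSpan n := by
  induction hA using Submodule.span_induction with
  | mem A hA =>
    obtain ⟨⟨β, α⟩, rfl⟩ := hA
    obtain ⟨B, hB, h⟩ := positionOp_mul_opPow_momentumOp i β
    simp only
    rw [← mul_assoc, h, add_mul, mul_assoc, ← opPow_raise commute_positionOp]
    exact Submodule.add_mem _ (Submodule.subset_span ⟨(β, raise α i), rfl⟩)
      (momentumSpan_mul_mem_normalSpan hB α)
  | zero => rw [mul_zero]; exact Submodule.zero_mem _
  | add A B _ _ hA hB => rw [mul_add]; exact Submodule.add_mem _ hA hB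
  | smul c A _ hA => rw [mul_smul_comm]; exact Submodule.smul_mem _ _ hA

theorem numberOp_pow_mul_mem_normalSpan (i : Fin n) (k : ℕ)
    {A : 𝓢(Conf n, ℂ) →L[ℂ] 𝓢(Conf n, ℂ)} (hA : A ∈ normalSpan n) :
    numberOp n i ^ k * A ∈ normalSpan n := by
  induction k with
  | zero => simpa
  | succ k ih =>
    rw [pow_succ', mul_assoc, numberOp, add_mul, mul_assoc, mul_assoc]
    exact Submodule.add_mem _
      (momentumOp_mul_mem_normalSpan i (momentumOp_mul_mem_normalSpan i ih))
      (positionOp_mul_mem_normalSpan i (positionOp_mul_mem_normalSpan i ih))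

/-- The normally ordered span is stable under left multiplication by P_i and Q_i. This lets the
seminorms of Schwartz operators, which test only words P^β Q^α, control powers of P_i² + Q_i². -/
theorem opPow_numberOp_mem_normalSpan (α : MultiIndex n) :
    opPow (numberOp n) α ∈ normalSpan n := by
  have h : ∀ l : List (Fin n), (l.map fun i => numberOp n i ^ α i).prod ∈ normalSpan n := by
    intro l
    induction l with
    | nil =>
      refine Submodule.subset_span ⟨(0, 0), ?_⟩
      simp [opPow_zero]
    | cons i l ih =>
      rw [List.map_cons, List.prod_cons]
      exact numberOp_pow_mul_mem_normalSpan i _ ih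
  have := h (List.finRange n)
  rwa [← List.ofFn_eq_map] at this

/-! ### From Schwartz operators to multisequences -/

namespace SchwartzOperator

/-- The matrix elements of `T` between `A ψ` and `B φ`, for `ψ, φ` in the unit ball, are bounded by
a continuous seminorm of `T`. -/
def HasFormBound (A B : 𝓢(Conf N, ℂ) →L[ℂ] 𝓢(Conf N, ℂ)) : Prop :=
  ∃ p : Seminorm ℂ (SchwartzOperator N), Continuous p ∧
    ∀ (T : SchwartzOperator N) (ψ φ : 𝓢(Conf N, ℂ)), ‖ψ.toLp 2 volume‖ ≤ 1 →
      ‖φ.toLp 2 volume‖ ≤ 1 →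
      ‖inner ℂ ((A ψ).toLp 2 volume) (T.toCLM ((B φ).toLp 2 volume))‖ ≤ p T

theorem continuous_seminormFamily (a : MultiIndex N × MultiIndex N × MultiIndex N × MultiIndex N) :
    Continuous (seminormFamily N a) :=
  withSeminorms.continuous_seminorm a

theorem toLp_add (f g : 𝓢(Conf n, ℂ)) :
    (f + g).toLp 2 volume = f.toLp 2 volume + g.toLp 2 volume :=
  (SchwartzMap.toLpCLM ℂ ℂ 2 (volume : Measure (Conf n))).map_add f g

theorem toLp_smul (c : ℂ) (f : 𝓢(Conf n, ℂ)) :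
    (c • f).toLp 2 volume = c • f.toLp 2 volume :=
  (SchwartzMap.toLpCLM ℂ ℂ 2 (volume : Measure (Conf n))).map_smul c f

theorem toLp_zero : (0 : 𝓢(Conf n, ℂ)).toLp 2 volume = 0 :=
  (SchwartzMap.toLpCLM ℂ ℂ 2 (volume : Measure (Conf n))).map_zero

theorem hasFormBound_momPos (α α' β β' : MultiIndex N) :
    HasFormBound (opPow (momentumOp N) β * opPow (positionOp N) α)
      (opPow (momentumOp N) β' * opPow (positionOp N) α') :=
  ⟨seminormFamily N (α, α', β, β'), continuous_seminormFamily _, fun T ψ φ hψ hφ =>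
    le_csSup (T.2 α α' β β') ⟨ψ, φ, hψ, hφ, rfl⟩⟩

theorem HasFormBound.of_mem_normalSpan_right {A B : 𝓢(Conf N, ℂ) →L[ℂ] 𝓢(Conf N, ℂ)}
    (h : ∀ α' β', HasFormBound A (opPow (momentumOp N) β' * opPow (positionOp N) α'))
    (hB : B ∈ normalSpan N) : HasFormBound A B := by
  induction hB using Submodule.span_induction with
  | mem B hB =>
    obtain ⟨⟨β, α⟩, rfl⟩ := hB
    exact h α β
  | zero => exact ⟨0, continuous_const, fun T ψ φ _ _ => by simp [toLp_zero]⟩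
  | add B C _ _ hB hC =>
    obtain ⟨p, hp, hp'⟩ := hB
    obtain ⟨r, hr, hr'⟩ := hC
    refine ⟨p + r, hp.add hr, fun T ψ φ hψ hφ => ?_⟩
    rw [_root_.add_apply, toLp_add, map_add, inner_add_right]
    exact (norm_add_le _ _).trans (add_le_add (hp' T ψ φ hψ hφ) (hr' T ψ φ hψ hφ))
  | smul c B _ hB =>
    obtain ⟨p, hp, hp'⟩ := hB
    refine ⟨‖c‖₊ • p, hp.const_smul ‖c‖₊, fun T ψ φ hψ hφ => ?_⟩
    rw [_root_.smul_apply, toLp_smul, map_smul, inner_smul_right, norm_mul]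
    exact mul_le_mul_of_nonneg_left (hp' T ψ φ hψ hφ) (norm_nonneg c)

/-- For words the bound is a defining seminorm. Linearity in B and antilinearity in A extend it to
spans, since only absolute values are estimated. -/
theorem HasFormBound.of_mem_normalSpan {A B : 𝓢(Conf N, ℂ) →L[ℂ] 𝓢(Conf N, ℂ)}
    (hA : A ∈ normalSpan N) (hB : B ∈ normalSpan N) : HasFormBound A B := by
  refine of_mem_normalSpan_right (fun α' β' => ?_) hB
  induction hA using Submodule.span_induction with
  | mem A hA =>
    obtain ⟨⟨β, α⟩, rfl⟩ := hA
    exact hasFormBound_momPos α α' β β'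
  | zero => exact ⟨0, continuous_const, fun T ψ φ _ _ => by simp [toLp_zero]⟩
  | add B C _ _ hB hC =>
    obtain ⟨p, hp, hp'⟩ := hB
    obtain ⟨r, hr, hr'⟩ := hC
    refine ⟨p + r, hp.add hr, fun T ψ φ hψ hφ => ?_⟩
    rw [_root_.add_apply, toLp_add, inner_add_left]
    exact (norm_add_le _ _).trans (add_le_add (hp' T ψ φ hψ hφ) (hr' T ψ φ hψ hφ))
  | smul c B _ hB =>
    obtain ⟨p, hp, hp'⟩ := hB
    refine ⟨‖c‖₊ • p, hp.const_smul ‖c‖₊, fun T ψ φ hψ hφ => ?_⟩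
    rw [_root_.smul_apply, toLp_smul, inner_smul_left, norm_mul, RCLike.norm_conj]
    exact mul_le_mul_of_nonneg_left (hp' T ψ φ hψ hφ) (norm_nonneg c)

end SchwartzOperator

/-- The first half of a multi-index. -/
def leftPart (γ : MultiIndex (N + N)) : MultiIndex N := fun i => γ (Fin.castAdd N i)

/-- The second half of a multi-index. -/
def rightPart (γ : MultiIndex (N + N)) : MultiIndex N := fun i => γ (Fin.natAdd N i)

theorem matrixOf_apply (T : HSpace N →L[ℂ] HSpace N) (γ : MultiIndex (N + N)) :
    matrixOf T γ = inner ℂ (numberState (leftPart γ)) (T (numberState (rightPart γ))) := rfl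

theorem basicWeight_eq_leftPart_mul_rightPart (γ : MultiIndex (N + N)) :
    basicWeight γ = basicWeight (leftPart γ) * basicWeight (rightPart γ) :=
  Fin.prod_univ_add _

/-- Test T between ∏(P_i² + Q_i²)^k|α⟩ and ∏(P_i² + Q_i²)^k|α'⟩: the eigenvalues on the two sides
together dominate the k-th power of the weight of α∨α'. -/
theorem exists_bound_matrixOf (N k : ℕ) : ∃ p : Seminorm ℂ (SchwartzOperator N), Continuous p ∧
    ∀ (T : SchwartzOperator N) γ, basicWeight γ ^ k * ‖matrixOf T.toCLM γ‖ ≤ p T := by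
  obtain ⟨p, hp, h⟩ := SchwartzOperator.HasFormBound.of_mem_normalSpan
    (opPow_numberOp_mem_normalSpan (n := N) fun _ => k)
    (opPow_numberOp_mem_normalSpan (n := N) fun _ => k)
  refine ⟨p, hp, fun T γ => le_trans ?_ (h T (numberSchwartz (leftPart γ))
    (numberSchwartz (rightPart γ)) ?_ ?_)⟩
  · rw [opPow_numberOp_numberSchwartz, opPow_numberOp_numberSchwartz, SchwartzOperator.toLp_smul,
      SchwartzOperator.toLp_smul, map_smul, inner_smul_left, inner_smul_right, norm_mul, norm_mul,
      RCLike.norm_conj, basicWeight_eq_leftPart_mul_rightPart, mul_pow, mul_assoc]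
    have h1 := basicWeight_le_norm (leftPart γ) k
    have h2 := basicWeight_le_norm (rightPart γ) k
    have h3 := basicWeight_pos (rightPart γ)
    exact mul_le_mul h1 (mul_le_mul_of_nonneg_right h2 (norm_nonneg _)) (by positivity)
      (norm_nonneg _)
  · rw [toLp_numberSchwartz, orthonormal_numberState.norm_eq_one]
  · rw [toLp_numberSchwartz, orthonormal_numberState.norm_eq_one]

theorem SchwartzOperator.isSchwartzSeq_matrixOf (T : SchwartzOperator N) :
    IsSchwartzSeq (matrixOf T.toCLM) :=
  isSchwartzSeq_of_bound fun k =>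
    let ⟨_, _, h⟩ := exists_bound_matrixOf N k
    ⟨_, h T⟩

/-- The map from a Schwartz operator to its matrix in the number basis. -/
def matrixMap (N : ℕ) : SchwartzOperator N →ₗ[ℂ] SchwartzSeq (N + N) where
  toFun T := ⟨matrixOf T.toCLM, T.isSchwartzSeq_matrixOf⟩
  map_add' _ _ := Subtype.ext (funext fun _ => inner_add_right _ _ _)
  map_smul' _ _ := Subtype.ext (funext fun _ => inner_smul_right _ _ _)

theorem continuous_matrixMap (N : ℕ) : Continuous (matrixMap N) := by
  have := (SchwartzOperator.withSeminorms (N := N)).topologicalAddGroup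
  refine SchwartzSeq.withSeminorms.continuous_of_continuous_comp _ fun α => ?_
  obtain ⟨p, hp, h⟩ := exists_bound_matrixOf N (∑ i, α i + 1)
  have hp' : Continuous ((√(weightSum (N + N))).toNNReal • p) :=
    hp.const_smul (√(weightSum (N + N))).toNNReal
  refine Seminorm.continuous_of_le hp' fun T => ?_
  refine (SchwartzSeq.seminormFamily_le_of_bound (matrixMap N T) α (apply_nonneg p T)
    (h T)).trans_eq ?_
  rw [_root_.smul_apply, NNReal.smul_def, Real.coe_toNNReal _ (Real.sqrt_nonneg _)]
  rfl

theorem matrixOf_injective :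
    Function.Injective (matrixOf : (HSpace N →L[ℂ] HSpace N) → MultiIndex (N + N) → ℂ) := by
  intro S T h
  refine ContinuousLinearMap.ext_on
    (dense_iff_closure_eq.2 (congrArg SetLike.coe (numberBasis N).dense_span)) ?_
  rintro _ ⟨α', rfl⟩
  rw [numberBasis_apply]
  refine eq_of_inner_numberState_eq fun α => ?_
  rw [← matrixOf_append, ← matrixOf_append, h]

/-! ### From multisequences to Schwartz operators -/

/-- The rank one operator `|α⟩⟨α'|`. -/
def matrixUnit (γ : MultiIndex (N + N)) : HSpace N →L[ℂ] HSpace N :=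
  InnerProductSpace.rankOne ℂ (numberState (leftPart γ)) (numberState (rightPart γ))

theorem inner_matrixUnit (γ : MultiIndex (N + N)) (ψ φ : HSpace N) :
    inner ℂ ψ (matrixUnit γ φ) =
      inner ℂ ψ (numberState (leftPart γ)) * inner ℂ (numberState (rightPart γ)) φ := by
  rw [matrixUnit, InnerProductSpace.rankOne_apply, inner_smul_right, mul_comm]

theorem norm_matrixUnit (γ : MultiIndex (N + N)) : ‖matrixUnit γ‖ = 1 := by
  rw [matrixUnit, InnerProductSpace.norm_rankOne, orthonormal_numberState.norm_eq_one,
    orthonormal_numberState.norm_eq_one, one_mul]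

/-- The operator `∑ a_{α∨α'} |α⟩⟨α'|`. -/
def operatorOf (a : SchwartzSeq (N + N)) : HSpace N →L[ℂ] HSpace N :=
  ∑' γ, a.toFun γ • matrixUnit γ

/-- Rank one operators between unit vectors have norm 1 and a is in ℓ¹, so the series converges in
operator norm. -/
theorem hasSum_operatorOf (a : SchwartzSeq (N + N)) :
    HasSum (fun γ => a.toFun γ • matrixUnit γ) (operatorOf a) := by
  refine Summable.hasSum (Summable.of_norm ?_)
  simpa [norm_smul, norm_matrixUnit] using a.summable_norm

theorem hasSum_inner_operatorOf (a : SchwartzSeq (N + N)) (ψ φ : HSpace N) :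
    HasSum (fun γ => a.toFun γ * (inner ℂ ψ (numberState (leftPart γ)) *
      inner ℂ (numberState (rightPart γ)) φ)) (inner ℂ ψ (operatorOf a φ)) := by
  have h := (hasSum_operatorOf a).mapL
    ((innerSL ℂ ψ).comp (ContinuousLinearMap.apply ℂ (HSpace N) φ))
  convert! h using 2 with γ
  simp [inner_matrixUnit]

theorem eq_iff_parts (γ δ : MultiIndex (N + N)) :
    γ = δ ↔ leftPart γ = leftPart δ ∧ rightPart γ = rightPart δ := by
  refine ⟨fun h => by simp [h], fun ⟨h1, h2⟩ => funext fun i => ?_⟩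
  refine Fin.addCases (fun i => congrFun h1 i) (fun i => congrFun h2 i) i

theorem matrixOf_operatorOf (a : SchwartzSeq (N + N)) : matrixOf (operatorOf a) = a.toFun := by
  funext δ
  have h := hasSum_inner_operatorOf a (numberState (leftPart δ)) (numberState (rightPart δ))
  rw [matrixOf_apply]
  refine h.unique ?_
  convert! hasSum_ite_eq δ (a.toFun δ) using 2 with γ
  rw [orthonormal_iff_ite.1 orthonormal_numberState, orthonormal_iff_ite.1 orthonormal_numberState]
  by_cases hγ : γ = δ
  · simp [hγ]
  · rw [if_neg hγ]
    by_cases h1 : leftPart δ = leftPart γ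
    · have h2 : rightPart γ ≠ rightPart δ := fun h2 => hγ ((eq_iff_parts γ δ).2 ⟨h1.symm, h2⟩)
      simp [h2]
    · simp [h1]

theorem exists_isFormalAdjoint_momPos (α β : MultiIndex N) :
    ∃ B, IsFormalAdjoint (opPow (momentumOp N) β * opPow (positionOp N) α) B := by
  obtain ⟨B, hB⟩ := exists_isFormalAdjoint_opPow (isFormalAdjoint_momentumOp (n := N)) β
  obtain ⟨C, hC⟩ := exists_isFormalAdjoint_opPow (isFormalAdjoint_positionOp (n := N)) α
  exact ⟨_, hB.mul hC⟩

/-- Moving P^β Q^α onto |γ⟩ leaves only the norm of ψ, and the image of |γ⟩ under the fixed adjoint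
grows polynomially. -/
theorem exists_norm_inner_momPos_le (α β : MultiIndex N) : ∃ (C : ℝ) (m : ℕ), 0 ≤ C ∧
    ∀ (ψ : 𝓢(Conf N, ℂ)) (γ : MultiIndex N), ‖ψ.toLp 2 volume‖ ≤ 1 →
      ‖inner ℂ ((momPos β α ψ).toLp 2 volume) (numberState γ)‖ ≤ C * basicWeight γ ^ m := by
  obtain ⟨B, hB⟩ := exists_isFormalAdjoint_momPos α β
  obtain ⟨C, m, hC, h⟩ :=
    exists_norm_map_numberSchwartz_le ((SchwartzMap.toLpCLM ℂ ℂ 2 volume : _ →L[ℂ] HSpace N).comp B)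
  refine ⟨C, m, hC, fun ψ γ hψ => le_trans ?_ (h γ)⟩
  rw [← toLp_numberSchwartz]
  have e := hB ψ (numberSchwartz γ)
  refine (congrArg norm e).le.trans ((norm_inner_le_norm _ _).trans ?_)
  exact mul_le_of_le_one_left (norm_nonneg _) hψ

theorem exists_bound_formValues_operatorOf (α α' β β' : MultiIndex N) : ∃ (C : ℝ) (m : ℕ), 0 ≤ C ∧
    ∀ (a : SchwartzSeq (N + N)), ∀ r ∈ formValues α α' β β' (operatorOf a),
      r ≤ C * SchwartzSeq.seminormFamily (N + N) (fun _ => m) a := by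
  obtain ⟨C, m, hC, h⟩ := exists_norm_inner_momPos_le α β
  obtain ⟨D, k, hD, h'⟩ := exists_norm_inner_momPos_le α' β'
  refine ⟨C * D * weightSum (N + N), m + k + 2,
    mul_nonneg (mul_nonneg hC hD) (weightSum_nonneg _), ?_⟩
  rintro a r ⟨ψ, φ, hψ, hφ, rfl⟩
  have hs := hasSum_inner_operatorOf a ((momPos β α ψ).toLp 2 volume)
    ((momPos β' α' φ).toLp 2 volume)
  have hx : ∀ γ : MultiIndex (N + N),
      ‖inner ℂ ((momPos β α ψ).toLp 2 volume) (numberState (leftPart γ)) *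
        inner ℂ (numberState (rightPart γ)) ((momPos β' α' φ).toLp 2 volume)‖ ≤
      C * D * basicWeight γ ^ (m + k) := by
    intro γ
    have h1 := h ψ (leftPart γ) hψ
    have h2 := h' φ (rightPart γ) hφ
    rw [norm_inner_symm] at h2
    have w1 := one_le_basicWeight (leftPart γ)
    have w2 := one_le_basicWeight (rightPart γ)
    rw [norm_mul]
    calc _ ≤ (C * basicWeight (leftPart γ) ^ m) * (D * basicWeight (rightPart γ) ^ k) :=
          mul_le_mul h1 h2 (norm_nonneg _) ((norm_nonneg _).trans h1)
      _ = C * D * (basicWeight (leftPart γ) ^ m * basicWeight (rightPart γ) ^ k) := by ring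
      _ ≤ C * D * (basicWeight (leftPart γ) ^ (m + k) * basicWeight (rightPart γ) ^ (m + k)) := by
          gcongr
          · exact Nat.le_add_right m k
          · exact Nat.le_add_left k m
      _ = _ := by rw [basicWeight_eq_leftPart_mul_rightPart, mul_pow]
  obtain ⟨s1, s2⟩ := a.summable_norm_mul_of_le (fun γ => norm_nonneg _) hx
  rw [← hs.tsum_eq]
  refine le_trans (norm_tsum_le_tsum_norm ?_) (le_trans (le_of_eq ?_) s2)
  · simpa only [norm_mul] using s1
  · simp only [norm_mul]

theorem isSchwartzOperator_operatorOf (a : SchwartzSeq (N + N)) :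
    IsSchwartzOperator (operatorOf a) := fun α α' β β' =>
  let ⟨_, _, _, h⟩ := exists_bound_formValues_operatorOf α α' β β'
  ⟨_, fun r hr => h a r hr⟩

/-- The operator `∑ a_{α∨α'} |α⟩⟨α'|` as a Schwartz operator. -/
def schwartzOperatorOf (a : SchwartzSeq (N + N)) : SchwartzOperator N :=
  ⟨operatorOf a, isSchwartzOperator_operatorOf a⟩

theorem isSchwartzOperator_iff_isSchwartzSeq (T : HSpace N →L[ℂ] HSpace N) :
    IsSchwartzOperator T ↔ IsSchwartzSeq (matrixOf T) := by
  refine ⟨fun h => SchwartzOperator.isSchwartzSeq_matrixOf ⟨T, h⟩, fun h => ?_⟩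
  -- T is recovered from its matrix, because the two operators have the same matrix elements.
  have e : operatorOf (⟨matrixOf T, h⟩ : schwartzSeqSubmodule (N + N)) = T :=
    matrixOf_injective (matrixOf_operatorOf _)
  rw [← e]
  exact isSchwartzOperator_operatorOf _

/-- The topological isomorphism between Schwartz operators and their matrices. -/
def matrixEquiv (N : ℕ) : SchwartzOperator N ≃L[ℂ] SchwartzSeq (N + N) :=
  let e : SchwartzOperator N ≃ₗ[ℂ] SchwartzSeq (N + N) :=
    { matrixMap N with
      invFun := schwartzOperatorOf
      left_inv := fun _ => Subtype.ext (matrixOf_injective (matrixOf_operatorOf _))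
      right_inv := fun a => SchwartzSeq.ext (matrixOf_operatorOf a) }
  { e with
    continuous_toFun := continuous_matrixMap N
    continuous_invFun := by
      have := SchwartzSeq.withSeminorms (n := N + N).topologicalAddGroup
      refine SchwartzOperator.withSeminorms.continuous_of_continuous_comp
        (e.symm : SchwartzSeq (N + N) →ₗ[ℂ] SchwartzOperator N) fun i => ?_
      obtain ⟨C, m, hC, h⟩ := exists_bound_formValues_operatorOf i.1 i.2.1 i.2.2.1 i.2.2.2
      have hp : Continuous (C.toNNReal • SchwartzSeq.seminormFamily (N + N) fun _ => m) :=
        (SchwartzSeq.withSeminorms.continuous_seminorm _).const_smul C.toNNReal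
      refine Seminorm.continuous_of_le hp fun a => ?_
      refine (csSup_le (formValues_nonempty _ _ _ _ _) (h a)).trans_eq ?_
      rw [_root_.smul_apply, NNReal.smul_def, Real.coe_toNNReal _ hC]
      rfl }

theorem toFun_matrixEquiv (T : SchwartzOperator N) :
    (matrixEquiv N T).toFun = matrixOf T.toCLM := rfl

end

end SchwartzOperators

namespace SchwartzOperators

noncomputable section

variable {N : ℕ}

/-! ### Splitting the variables -/

/-- The identification of `ℝ^{2N}` with `ℝ^N × ℝ^N`. -/
def splitEquiv (N : ℕ) : Conf (N + N) ≃L[ℝ] Conf N × Conf N := EuclideanSpace.finAddEquivProd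

theorem splitEquiv_fst (x : Conf (N + N)) (i : Fin N) :
    (splitEquiv N x).1 i = x (Fin.castAdd N i) := rfl

theorem splitEquiv_snd (x : Conf (N + N)) (i : Fin N) :
    (splitEquiv N x).2 i = x (Fin.natAdd N i) := rfl

theorem measurePreserving_splitEquiv (N : ℕ) : MeasurePreserving (splitEquiv N) := by
  have h1 := PiLp.volume_preserving_ofLp (Fin (N + N))
  have h2 := volume_measurePreserving_piCongrLeft (fun _ : Fin N ⊕ Fin N => ℝ)
    (finSumFinEquiv (m := N) (n := N)).symm
  have h3 := volume_measurePreserving_sumPiEquivProdPi (fun _ : Fin N ⊕ Fin N => ℝ)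
  have h4 := (PiLp.volume_preserving_toLp (Fin N)).prod (PiLp.volume_preserving_toLp (Fin N))
  -- Forget the Euclidean norm, reindex by a disjoint union, split the product, and restore the norm
  -- on each factor.
  have h := h4.comp (h3.comp (h2.comp h1))
  convert! h using 1
  have hc : ∀ (x : Fin (N + N) → ℝ) (s : Fin N ⊕ Fin N),
      MeasurableEquiv.piCongrLeft (fun _ : Fin N ⊕ Fin N => ℝ)
        (finSumFinEquiv (m := N) (n := N)).symm x s = x (finSumFinEquiv s) := fun x s => by
    have e := MeasurableEquiv.piCongrLeft_apply_apply (finSumFinEquiv (m := N) (n := N)).symm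
      (β := fun _ : Fin N ⊕ Fin N => ℝ) x (finSumFinEquiv s)
    rwa [Equiv.symm_apply_apply] at e
  funext x
  refine Prod.ext ?_ ?_
  · ext i
    exact (hc x.ofLp (.inl i)).symm
  · ext i
    exact (hc x.ofLp (.inr i)).symm

theorem measurePreserving_splitEquiv_symm (N : ℕ) : MeasurePreserving (splitEquiv N).symm :=
  (measurePreserving_splitEquiv N).symm (splitEquiv N).toHomeomorph.toMeasurableEquiv

/-- The kernel as a function on `ℝ^{2N}`. -/
def mergeKernel (K : KernelSpace N) : HSpace (N + N) :=
  Lp.compMeasurePreserving (splitEquiv N) (measurePreserving_splitEquiv N) K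

/-- A function on `ℝ^{2N}` as a kernel. -/
def splitKernel (f : HSpace (N + N)) : KernelSpace N :=
  Lp.compMeasurePreserving (splitEquiv N).symm (measurePreserving_splitEquiv_symm N) f

theorem mergeKernel_ae (K : KernelSpace N) : mergeKernel K =ᵐ[volume] K ∘ splitEquiv N :=
  Lp.coeFn_compMeasurePreserving _ _

theorem splitKernel_ae (f : HSpace (N + N)) : splitKernel f =ᵐ[volume] f ∘ (splitEquiv N).symm :=
  Lp.coeFn_compMeasurePreserving _ _

theorem mergeKernel_splitKernel (f : HSpace (N + N)) : mergeKernel (splitKernel f) = f := by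
  refine Lp.ext ((mergeKernel_ae _).trans ?_)
  have h := (measurePreserving_splitEquiv N).quasiMeasurePreserving.ae_eq_comp (splitKernel_ae f)
  refine h.trans (.of_forall fun x => ?_)
  simp

theorem mergeKernel_injective : Function.Injective (mergeKernel (N := N)) :=
  (Lp.isometry_compMeasurePreserving (measurePreserving_splitEquiv N)).injective

theorem numberFun_leftPart_mul_rightPart (γ : MultiIndex (N + N)) (x : Conf (N + N)) :
    numberFun (leftPart γ) (splitEquiv N x).1 * numberFun (rightPart γ) (splitEquiv N x).2 =
      numberFun γ x := by
  simp only [numberFun, splitEquiv_fst, splitEquiv_snd, leftPart, rightPart]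
  rw [Fin.prod_univ_add]
  push_cast
  rfl

theorem conj_numberFun {n : ℕ} (γ : MultiIndex n) (x : Conf n) :
    starRingEnd ℂ (numberFun γ x) = numberFun γ x :=
  Complex.conj_ofReal _

theorem numberState_ae {n : ℕ} (γ : MultiIndex n) :
    numberState γ =ᵐ[volume] numberFun γ := MemLp.coeFn_toLp _

/-- Number functions are real and multiply across the two halves of the variables, so this form of K
is one Hermite coefficient on ℝ^{2N}. -/
theorem integral_kernel_numberState (K : KernelSpace N) (γ : MultiIndex (N + N)) :
    ∫ z : Conf N × Conf N, starRingEnd ℂ (numberState (leftPart γ) z.1) * K z *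
      numberState (rightPart γ) z.2 = inner ℂ (numberState γ) (mergeKernel K) := by
  rw [L2.inner_def, ← (measurePreserving_splitEquiv N).integral_comp
    (splitEquiv N).toHomeomorph.measurableEmbedding]
  refine integral_congr_ae ?_
  have hS := (measurePreserving_splitEquiv N).quasiMeasurePreserving
  have h1 := (Measure.quasiMeasurePreserving_fst.comp hS).ae_eq_comp
    (numberState_ae (leftPart γ))
  have h2 := (Measure.quasiMeasurePreserving_snd.comp hS).ae_eq_comp
    (numberState_ae (rightPart γ))
  filter_upwards [h1, h2, numberState_ae γ, mergeKernel_ae K] with x e1 e2 e3 e4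
  simp only [Function.comp] at e1 e2 e4
  rw [e1, e2, e3, e4, RCLike.inner_apply, conj_numberFun, conj_numberFun,
    ← numberFun_leftPart_mul_rightPart]
  ring

/-! ### The sesquilinear form of a kernel -/

theorem memLp_tensor (ψ φ : HSpace N) :
    MemLp (fun z : Conf N × Conf N => ψ z.1 * starRingEnd ℂ (φ z.2)) 2 volume := by
  have hm : AEStronglyMeasurable (fun z : Conf N × Conf N => ψ z.1 * starRingEnd ℂ (φ z.2))
      (volume : Measure (Conf N × Conf N)) :=
    (Lp.aestronglyMeasurable ψ).comp_fst.mul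
      (Complex.continuous_conj.comp_aestronglyMeasurable (Lp.aestronglyMeasurable φ).comp_snd)
  rw [memLp_two_iff_integrable_sq_norm hm]
  have h1 := (memLp_two_iff_integrable_sq_norm (Lp.aestronglyMeasurable ψ)).1 (Lp.memLp ψ)
  have h2 := (memLp_two_iff_integrable_sq_norm (Lp.aestronglyMeasurable φ)).1 (Lp.memLp φ)
  refine (h1.mul_prod h2).congr (.of_forall fun z => ?_)
  simp [mul_pow]

/-- The vector `ψ ⊗ conj φ` of `L²(ℝ^{2N})`. -/
def tensor (ψ φ : HSpace N) : KernelSpace N := (memLp_tensor ψ φ).toLp _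

theorem tensor_ae (ψ φ : HSpace N) :
    tensor ψ φ =ᵐ[volume] fun z : Conf N × Conf N => ψ z.1 * starRingEnd ℂ (φ z.2) :=
  MemLp.coeFn_toLp _

theorem inner_tensor (ψ φ : HSpace N) (K : KernelSpace N) : inner ℂ (tensor ψ φ) K =
    ∫ z : Conf N × Conf N, starRingEnd ℂ (ψ z.1) * K z * φ z.2 := by
  rw [L2.inner_def]
  refine integral_congr_ae ?_
  filter_upwards [tensor_ae ψ φ] with z hz
  rw [hz, RCLike.inner_apply, map_mul, Complex.conj_conj]
  ring

theorem norm_sq_eq_integral {α : Type*} [MeasureSpace α] (f : Lp ℂ 2 (volume : Measure α)) :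
    ‖f‖ ^ 2 = ∫ x, ‖f x‖ ^ 2 := by
  have h := inner_self_eq_norm_sq_to_K (𝕜 := ℂ) f
  rw [L2.inner_def] at h
  have e : ∀ x, inner ℂ (f x) (f x) = ((‖f x‖ ^ 2 : ℝ) : ℂ) := fun x => by
    rw [inner_self_eq_norm_sq_to_K]; push_cast; rfl
  simp only [e] at h
  rw [integral_complex_ofReal] at h
  refine Complex.ofReal_injective ?_
  rw [Complex.ofReal_pow]
  exact h.symm

theorem norm_tensor (ψ φ : HSpace N) : ‖tensor ψ φ‖ = ‖ψ‖ * ‖φ‖ := by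
  rw [← sq_eq_sq₀ (norm_nonneg _) (by positivity), mul_pow, norm_sq_eq_integral,
    norm_sq_eq_integral, norm_sq_eq_integral, ← integral_prod_mul]
  refine integral_congr_ae ?_
  filter_upwards [tensor_ae ψ φ] with z hz
  rw [hz, norm_mul, RCLike.norm_conj, mul_pow]

theorem ae_fst {p : Conf N → Prop} (h : ∀ᵐ x, p x) : ∀ᵐ z : Conf N × Conf N, p z.1 :=
  Measure.quasiMeasurePreserving_fst.ae h

theorem ae_snd {p : Conf N → Prop} (h : ∀ᵐ x, p x) : ∀ᵐ z : Conf N × Conf N, p z.2 :=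
  Measure.quasiMeasurePreserving_snd.ae h

theorem tensor_add_right (ψ φ χ : HSpace N) : tensor ψ (φ + χ) = tensor ψ φ + tensor ψ χ := by
  refine Lp.ext ?_
  filter_upwards [tensor_ae ψ (φ + χ), tensor_ae ψ φ, tensor_ae ψ χ, ae_snd (Lp.coeFn_add φ χ),
    Lp.coeFn_add (tensor ψ φ) (tensor ψ χ)] with z h1 h2 h3 h4 h5
  rw [h5, h1, Pi.add_apply, h2, h3, h4, Pi.add_apply, map_add, mul_add]

theorem tensor_smul_right (c : ℂ) (ψ φ : HSpace N) :
    tensor ψ (c • φ) = starRingEnd ℂ c • tensor ψ φ := by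
  refine Lp.ext ?_
  filter_upwards [tensor_ae ψ (c • φ), tensor_ae ψ φ, ae_snd (Lp.coeFn_smul c φ),
    Lp.coeFn_smul (starRingEnd ℂ c) (tensor ψ φ)] with z h1 h2 h3 h4
  rw [h4, h1, Pi.smul_apply, h2, h3, Pi.smul_apply, smul_eq_mul, smul_eq_mul, map_mul]
  ring

theorem tensor_add_left (ψ φ χ : HSpace N) : tensor (ψ + φ) χ = tensor ψ χ + tensor φ χ := by
  refine Lp.ext ?_
  filter_upwards [tensor_ae (ψ + φ) χ, tensor_ae ψ χ, tensor_ae φ χ, ae_fst (Lp.coeFn_add ψ φ),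
    Lp.coeFn_add (tensor ψ χ) (tensor φ χ)] with z h1 h2 h3 h4 h5
  rw [h5, h1, Pi.add_apply, h2, h3, h4, Pi.add_apply, add_mul]

theorem tensor_smul_left (c : ℂ) (ψ φ : HSpace N) :
    tensor (c • ψ) φ = c • tensor ψ φ := by
  refine Lp.ext ?_
  filter_upwards [tensor_ae (c • ψ) φ, tensor_ae ψ φ, ae_fst (Lp.coeFn_smul c ψ),
    Lp.coeFn_smul c (tensor ψ φ)] with z h1 h2 h3 h4
  rw [h4, h1, Pi.smul_apply, h2, h3, Pi.smul_apply, smul_eq_mul, smul_eq_mul]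
  ring

/-- The linear functional `φ ↦ ⟨ψ ⊗ conj φ, K⟩`. -/
def kernelFunctional (K : KernelSpace N) (ψ : HSpace N) : HSpace N →L[ℂ] ℂ :=
  LinearMap.mkContinuous
    { toFun := fun φ => inner ℂ (tensor ψ φ) K
      map_add' := fun φ χ => by rw [tensor_add_right, inner_add_left]
      map_smul' := fun c φ => by
        rw [tensor_smul_right, inner_smul_left, Complex.conj_conj]; rfl }
    (‖ψ‖ * ‖K‖) fun φ => by
      refine (norm_inner_le_norm (𝕜 := ℂ) (tensor ψ φ) K).trans_eq ?_
      rw [norm_tensor]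
      ring

/-- The linear functional `ψ ↦ ⟨K, ψ ⊗ conj φ⟩`. -/
def kernelFunctional' (K : KernelSpace N) (φ : HSpace N) : HSpace N →L[ℂ] ℂ :=
  LinearMap.mkContinuous
    { toFun := fun ψ => inner ℂ K (tensor ψ φ)
      map_add' := fun ψ χ => by rw [tensor_add_left, inner_add_right]
      map_smul' := fun c ψ => by rw [tensor_smul_left, inner_smul_right]; rfl }
    (‖φ‖ * ‖K‖) fun ψ => by
      refine (norm_inner_le_norm (𝕜 := ℂ) K (tensor ψ φ)).trans_eq ?_
      rw [norm_tensor]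
      ring

theorem clm_ext_numberState {F : Type*} [NormedAddCommGroup F] [NormedSpace ℂ F]
    {A B : HSpace N →L[ℂ] F} (h : ∀ α, A (numberState α) = B (numberState α)) : A = B := by
  refine ContinuousLinearMap.ext_on
    (dense_iff_closure_eq.2 (congrArg SetLike.coe (numberBasis N).dense_span)) ?_
  rintro _ ⟨α, rfl⟩
  rw [numberBasis_apply]
  exact h α

/-- Both sides of the kernel identity are bounded sesquilinear forms in ψ and φ, so agreement on the
number basis suffices. -/
theorem isKernel_iff (T : HSpace N →L[ℂ] HSpace N) (K : KernelSpace N) :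
    IsKernel T K ↔ ∀ γ, inner ℂ (numberState γ) (mergeKernel K) = matrixOf T γ := by
  refine ⟨fun h γ => ?_, fun h ψ φ => ?_⟩
  · rw [← integral_kernel_numberState, matrixOf_apply, h]
  · rw [← inner_tensor]
    have h1 : ∀ α, (innerSL ℂ (numberState α)).comp T = kernelFunctional K (numberState α) := by
      intro α
      refine clm_ext_numberState fun α' => ?_
      have h2 := h (Fin.append α α')
      have e1 : leftPart (Fin.append α α') = α := funext fun i => Fin.append_left _ _ _
      have e2 : rightPart (Fin.append α α') = α' := funext fun i => Fin.append_right _ _ _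
      rw [matrixOf_append, ← integral_kernel_numberState, ← inner_tensor, e1, e2] at h2
      exact h2.symm
    -- The identity now holds for all φ and basis vectors on the left. Conjugation makes it linear
    -- in ψ, so density applies again.
    have h3 : innerSL ℂ (T φ) = kernelFunctional' K φ := by
      refine clm_ext_numberState fun α => ?_
      have h4 : inner ℂ (numberState α) (T φ) = inner ℂ (tensor (numberState α) φ) K :=
        congrArg (fun L : HSpace N →L[ℂ] ℂ => L φ) (h1 α)
      have h5 := congrArg (starRingEnd ℂ) h4
      rwa [inner_conj_symm, inner_conj_symm] at h5
    have h6 : inner ℂ (T φ) ψ = inner ℂ K (tensor ψ φ) :=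
      congrArg (fun L : HSpace N →L[ℂ] ℂ => L ψ) h3
    have h7 := congrArg (starRingEnd ℂ) h6
    rwa [inner_conj_symm, inner_conj_symm] at h7

theorem IsKernel.unique {T : HSpace N →L[ℂ] HSpace N} {K L : KernelSpace N} (hK : IsKernel T K)
    (hL : IsKernel T L) : K = L := by
  rw [isKernel_iff] at hK hL
  exact mergeKernel_injective (eq_of_inner_numberState_eq fun γ => (hK γ).trans (hL γ).symm)

theorem isKernel_iff_eq_kernelOf {T : HSpace N →L[ℂ] HSpace N} (h : ∃ K, IsKernel T K)
    (K : KernelSpace N) : IsKernel T K ↔ K = kernelOf T := by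
  have hs : IsKernel T (kernelOf T) := by
    rw [kernelOf, dif_pos h]
    exact h.choose_spec
  exact ⟨fun hK => hK.unique hs, fun e => e ▸ hs⟩

/-! ### Hilbert–Schmidt operators -/

theorem HilbertBasis.hasSum_norm_inner_sq {ι E : Type*} [NormedAddCommGroup E]
    [InnerProductSpace ℂ E] (b : HilbertBasis ι ℂ E) (x : E) :
    HasSum (fun i => ‖(inner ℂ (b i) x : ℂ)‖ ^ 2) (‖x‖ ^ 2) := by
  have h := (b.hasSum_inner_mul_inner x x).mapL Complex.reCLM
  convert! h using 1
  · funext i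
    rw [Complex.reCLM_apply, ← inner_conj_symm x (b i), ← Complex.normSq_eq_conj_mul_self,
      Complex.ofReal_re, Complex.normSq_eq_norm_sq]
  · rw [Complex.reCLM_apply]
    exact (inner_self_eq_norm_sq (𝕜 := ℂ) x).symm

theorem summable_norm_sq_swap {ι κ : Type*} (b : HilbertBasis ι ℂ (HSpace N))
    (c : HilbertBasis κ ℂ (HSpace N)) {T : HSpace N →L[ℂ] HSpace N}
    (h : Summable fun i => ‖T (b i)‖ ^ 2) :
    Summable fun p : κ × ι => ‖(inner ℂ (c p.1) (T (b p.2)) : ℂ)‖ ^ 2 := by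
  have h1 : Summable fun p : ι × κ => ‖(inner ℂ (c p.2) (T (b p.1)) : ℂ)‖ ^ 2 := by
    rw [summable_prod_of_nonneg fun p => by positivity]
    refine ⟨fun i => (HilbertBasis.hasSum_norm_inner_sq c (T (b i))).summable, ?_⟩
    simpa only [(HilbertBasis.hasSum_norm_inner_sq c (T (b _))).tsum_eq] using h
  exact h1.prod_symm

/-- Sum the array |⟨c_k, T b_i⟩|² in two orders: by Parseval one gives ∑‖T b_i‖² and the other ∑‖T*
c_k‖². The two bases are unrelated. -/
theorem summable_norm_adjoint_sq {ι κ : Type*} (b : HilbertBasis ι ℂ (HSpace N))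
    (c : HilbertBasis κ ℂ (HSpace N)) {T : HSpace N →L[ℂ] HSpace N}
    (h : Summable fun i => ‖T (b i)‖ ^ 2) :
    Summable fun k => ‖ContinuousLinearMap.adjoint T (c k)‖ ^ 2 := by
  have h1 := ((summable_prod_of_nonneg fun p => by positivity).1 (summable_norm_sq_swap b c h)).2
  refine h1.congr fun k => ?_
  rw [← (HilbertBasis.hasSum_norm_inner_sq b _).tsum_eq]
  refine tsum_congr fun i => ?_
  rw [ContinuousLinearMap.adjoint_inner_right, norm_inner_symm]

/-- Splitting of a multi-index as an equivalence. -/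
def splitIndex (N : ℕ) : MultiIndex (N + N) ≃ MultiIndex N × MultiIndex N where
  toFun γ := (leftPart γ, rightPart γ)
  invFun p := Fin.append p.1 p.2
  left_inv _ := (eq_iff_parts _ _).2
    ⟨funext fun _ => Fin.append_left _ _ _, funext fun _ => Fin.append_right _ _ _⟩
  right_inv _ := Prod.ext (funext fun _ => Fin.append_left _ _ _)
    (funext fun _ => Fin.append_right _ _ _)

theorem isHilbertSchmidt_iff_summable (T : HSpace N →L[ℂ] HSpace N) :
    IsHilbertSchmidt T ↔ Summable fun γ => ‖matrixOf T γ‖ ^ 2 := by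
  have key : (Summable fun γ => ‖matrixOf T γ‖ ^ 2) ↔ Summable fun p : MultiIndex N × MultiIndex N =>
      ‖(inner ℂ (numberBasis N p.1) (T (numberBasis N p.2)) : ℂ)‖ ^ 2 := by
    rw [← (splitIndex N).summable_iff]
    simp only [numberBasis_apply]
    rfl
  rw [key]
  constructor
  · rintro ⟨ι, b, hb⟩
    -- Two passages to the adjoint replace the given basis by the number basis.
    have h1 := summable_norm_adjoint_sq b (numberBasis N) hb
    have h2 := summable_norm_adjoint_sq (numberBasis N) (numberBasis N) h1
    rw [ContinuousLinearMap.adjoint_adjoint] at h2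
    exact summable_norm_sq_swap (numberBasis N) (numberBasis N) h2
  · intro h
    refine ⟨MultiIndex N, numberBasis N, ?_⟩
    have h1 := ((summable_prod_of_nonneg fun p => by positivity).1 h.prod_symm).2
    refine h1.congr fun i => ?_
    exact (HilbertBasis.hasSum_norm_inner_sq (numberBasis N) (T (numberBasis N i))).tsum_eq

/-- Riesz–Fischer: the square summable matrix is the coefficient family of some L² function on
ℝ^{2N}, which is then split into a kernel. -/
theorem IsHilbertSchmidt.exists_isKernel {T : HSpace N →L[ℂ] HSpace N} (h : IsHilbertSchmidt T) :
    ∃ K, IsKernel T K := by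
  rw [isHilbertSchmidt_iff_summable] at h
  have hm : Memℓp (matrixOf T) 2 := by
    rw [memℓp_gen_iff (by norm_num)]
    simpa using h
  let f : HSpace (N + N) := (numberBasis (N + N)).repr.symm ⟨matrixOf T, hm⟩
  refine ⟨splitKernel f, (isKernel_iff _ _).2 fun γ => ?_⟩
  rw [mergeKernel_splitKernel, ← numberBasis_apply, ← HilbertBasis.repr_apply_apply,
    LinearIsometryEquiv.apply_symm_apply]

theorem IsSchwartzOperator.isHilbertSchmidt {T : HSpace N →L[ℂ] HSpace N}
    (h : IsSchwartzOperator T) : IsHilbertSchmidt T := by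
  rw [isHilbertSchmidt_iff_summable]
  have := (isSchwartzSeq_iff _).1 ((isSchwartzOperator_iff_isSchwartzSeq T).1 h) 0
  simpa using this

/-! ### Schwartz kernels -/

/-- The identification of the Schwartz functions on `ℝ^{2N}` and on `ℝ^N × ℝ^N`. -/
def splitSchwartz (N : ℕ) : 𝓢(Conf (N + N), ℂ) ≃L[ℂ] 𝓢(Conf N × Conf N, ℂ) :=
  ContinuousLinearEquiv.equivOfInverse
    (SchwartzMap.compCLMOfContinuousLinearEquiv ℂ (splitEquiv N).symm)
    (SchwartzMap.compCLMOfContinuousLinearEquiv ℂ (splitEquiv N))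
    (fun f => by ext x; simp) (fun f => by ext x; simp)

theorem mergeKernel_kernelOf {T : HSpace N →L[ℂ] HSpace N} (hT : IsHilbertSchmidt T)
    (γ : MultiIndex (N + N)) :
    inner ℂ (numberState γ) (mergeKernel (kernelOf T)) = matrixOf T γ :=
  (isKernel_iff _ _).1 ((isKernel_iff_eq_kernelOf hT.exists_isKernel _).2 rfl) γ

/-- The merged kernel and f have equal Hermite coefficients, so they coincide in L²; splitting the
variables preserves null sets. -/
theorem kernelOf_ae_eq_splitSchwartz {T : HSpace N →L[ℂ] HSpace N} (hT : IsHilbertSchmidt T)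
    {f : 𝓢(Conf (N + N), ℂ)} (hf : hermiteCoeff f = matrixOf T) :
    kernelOf T =ᵐ[volume] splitSchwartz N f := by
  have e : mergeKernel (kernelOf T) = f.toLp 2 volume := eq_of_inner_numberState_eq fun γ => by
    rw [mergeKernel_kernelOf hT, ← hf, hermiteCoeff]
  have e2 : kernelOf T = splitKernel (f.toLp 2 volume) := mergeKernel_injective (by
    rw [e, mergeKernel_splitKernel])
  rw [e2]
  refine (splitKernel_ae _).trans ?_
  exact (measurePreserving_splitEquiv_symm N).quasiMeasurePreserving.ae_eq_comp
    (f.coeFn_toLp 2 volume)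

theorem hermiteCoeff_splitSchwartz_symm {T : HSpace N →L[ℂ] HSpace N} (hT : IsHilbertSchmidt T)
    {k : 𝓢(Conf N × Conf N, ℂ)} (hk : kernelOf T =ᵐ[volume] k) :
    hermiteCoeff ((splitSchwartz N).symm k) = matrixOf T := by
  funext γ
  rw [← mergeKernel_kernelOf hT, hermiteCoeff]
  congr 1
  refine Lp.ext ((((splitSchwartz N).symm k).coeFn_toLp 2 volume).trans ?_)
  refine ((mergeKernel_ae _).trans ?_).symm
  exact (measurePreserving_splitEquiv N).quasiMeasurePreserving.ae_eq_comp hk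

end

end SchwartzOperators

/-! ### The equivalences and the topological isomorphisms. -/

theorem mainTheorem2 (N : ℕ) :
    (∀ T : HSpace N →L[ℂ] HSpace N, IsHilbertSchmidt T →
      (∀ K : KernelSpace N, IsKernel T K ↔ K = kernelOf T) ∧
      [IsSchwartzOperator T,
        ∃ k : 𝓢(Conf N × Conf N, ℂ), kernelOf T =ᵐ[volume] k,
        IsSchwartzSeq (matrixOf T)].TFAE) ∧
    (∀ T : SchwartzOperator N, IsHilbertSchmidt T.toCLM) ∧
    (∃ Φ : SchwartzOperator N ≃L[ℂ] 𝓢(Conf N × Conf N, ℂ),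
      ∀ T : SchwartzOperator N, kernelOf T.toCLM =ᵐ[volume] Φ T) ∧
    (∃ Ψ : SchwartzOperator N ≃L[ℂ] SchwartzSeq (N + N),
      ∀ T : SchwartzOperator N, (Ψ T).toFun = matrixOf T.toCLM) := by
  refine ⟨fun T hT => ⟨isKernel_iff_eq_kernelOf hT.exists_isKernel, ?_⟩,
    fun T => T.isSchwartzOperator.isHilbertSchmidt, ?_, matrixEquiv N, toFun_matrixEquiv⟩
  · tfae_have 1 ↔ 3 := isSchwartzOperator_iff_isSchwartzSeq T
    tfae_have 2 → 3 := fun ⟨k, hk⟩ =>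
      hermiteCoeff_splitSchwartz_symm hT hk ▸ isSchwartzSeq_hermiteCoeff _
    tfae_have 3 → 2 := fun h =>
      ⟨_, kernelOf_ae_eq_splitSchwartz hT (hermiteCoeff_hermiteEquiv_symm
        (⟨matrixOf T, h⟩ : schwartzSeqSubmodule (N + N)))⟩
    tfae_finish
  -- Operator to matrix, matrix to Hermite series on ℝ^{2N}, then separation of the variables.
  · refine ⟨((matrixEquiv N).trans (hermiteEquiv (N + N)).symm).trans (splitSchwartz N),
      fun T => ?_⟩
    exact kernelOf_ae_eq_splitSchwartz T.isSchwartzOperator.isHilbertSchmidt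
      ((hermiteCoeff_hermiteEquiv_symm _).trans (toFun_matrixEquiv T))
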